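/- Call a real number a Perron number if it is a positive algebraic integer that is strictly larger than the modulus of each of its other algebraic conjugates; call real numbers $\alpha,\beta$ multiplicatively independent if $\alpha^k\neq\beta^l$ for all integers $k,l>0$. A substitution on a finite alphabet $A$ is a map $\sigma:A\to A^*$, extended to words and (since no letter is erased) to sequences by concatenation, such that $\lim_{n\to\infty}|\sigma^n(a)|=+\infty$ for every $a\in A$; its dominant eigenvalue is the real eigenvalue of the matrix $M_\sigma=(m_{i,j})_{i,j\in A}$, where $m_{i,j}$ is the number of occurrences of the letter $i$ in $\sigma(j)$, that is greater than or equal to the modulus of every complex eigenvalue of $M_\sigma$. A proper fixed point of $\sigma$ is a sequence ${\bf y}\in A^{\mathbb N}$ with $\sigma({\bf y})={\bf y}$ in which every letter of $A$ occurs. Let $\alpha$ and $\beta$ be two multiplicatively independent Perron numbers. Let $\sigma$ and $\tau$ be substitutions on finite alphabets $A$ and $B$ with dominant eigenvalues $\alpha$ and $\beta$ and with proper fixed points ${\bf y}\in A^{\mathbb N}$ and ${\bf z}\in B^{\mathbb N}$ respectively. Let $C$ be a finite alphabet and let $\phi:A\to C$ and $\psi:B\to C$ be letter-to-letter morphisms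 such that $\phi({\bf y})=\psi({\bf z})={\bf x}$. Then every word $u\in C^*$ that has infinitely many occurrences in ${\bf x}$ appears in ${\bf x}$ with bounded gaps: there is an integer $K$ such that every set of $K$ consecutive integers $\geq 0$ contains an $i$ with ${\bf x}_i{\bf x}_{i+1}\cdots{\bf x}_{i+|u|-1}=u$. -/

import Mathlib

namespace CobhamSubst

/-- The factor `x_i x_{i+1} ⋯ x_{i+n-1}` of length `n` of the sequence `x` at position `i`. -/
def factor {A : Type*} (x : ℕ → A) (i n : ℕ) : List A :=
  (List.range n).map fun k => x (i + k)

/-- The occurrences of the word `u` in the sequence `x`. -/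
def occurrences {A : Type*} (x : ℕ → A) (u : List A) : Set ℕ :=
  {i | factor x i u.length = u}

/-- A set of positions has bounded gaps: for some `K`, every window of `K` consecutive
positions meets it. -/
def HasBoundedGaps (E : Set ℕ) : Prop :=
  ∃ K : ℕ, ∀ n : ℕ, ∃ i ∈ E, n ≤ i ∧ i < n + K

/-- The map on words induced by the morphism `σ : A → B*`. -/
def applyWord {A B : Type*} (σ : A → List B) (w : List A) : List B :=
  w.flatMap σ

/-- The matrix of the morphism `σ`: its `(i, j)` entry counts the occurrences of `i` in `σ j`. -/
def incidenceMatrix {A B : Type*} [DecidableEq B] (σ : A → List B) : Matrix B A ℕ :=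
  Matrix.of fun i j => (σ j).count i

/-- A substitution: `|σⁿ(a)| → ∞` for every letter `a`. (In particular no letter is erased.) -/
def IsSubstitution {A : Type*} (σ : A → List A) : Prop :=
  ∀ a : A, Filter.Tendsto (fun n : ℕ => ((applyWord σ)^[n] [a]).length) Filter.atTop Filter.atTop

/-- `σ(x) = y` for sequences: the image of every prefix of `x` is a prefix of `y`. For a
morphism that erases no letter these images are arbitrarily long, so `y` is unique. -/
def IsSeqImage {A B : Type*} (σ : A → List B) (x : ℕ → A) (y : ℕ → B) : Prop :=
  ∀ n : ℕ, applyWord σ (factor x 0 n) = factor y 0 (applyWord σ (factor x 0 n)).length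

/-- A fixed point of `σ` in which every letter of the alphabet occurs. -/
def IsProperFixedPoint {A : Type*} (σ : A → List A) (y : ℕ → A) : Prop :=
  IsSeqImage σ y y ∧ ∀ a : A, ∃ n : ℕ, y n = a

/-- The real number `r` is an eigenvalue of `M`, and it is at least the modulus of every complex
eigenvalue of `M`. -/
def IsDominantEigenvalue {A : Type*} [Fintype A] [DecidableEq A] (M : Matrix A A ℕ) (r : ℝ) :
    Prop :=
  Module.End.HasEigenvalue (Matrix.toLin' (M.map (Nat.cast : ℕ → ℂ))) (r : ℂ) ∧
    ∀ z : ℂ, Module.End.HasEigenvalue (Matrix.toLin' (M.map (Nat.cast : ℕ → ℂ))) z → ‖z‖ ≤ r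

/-- A Perron number: a positive real algebraic integer that strictly dominates its other
algebraic conjugates. -/
def IsPerronNumber (r : ℝ) : Prop :=
  0 < r ∧ IsIntegral ℤ r ∧
    ∀ z : ℂ, Polynomial.aeval z (minpoly ℚ r) = 0 → z ≠ (r : ℂ) → ‖z‖ < r

/-- Multiplicative independence. -/
def MultiplicativelyIndependent (r s : ℝ) : Prop :=
  ∀ k l : ℕ, 0 < k → 0 < l → r ^ k ≠ s ^ l

end CobhamSubst

/-! The fixed point of a substitution is cut, at each level `n`, into the blocks `σⁿ(y k)`, with
block boundaries `s^[n] k`. Let `E` be the set of occurrences of `u`, and suppose that its gaps are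
unbounded. Then `firstGap E L`, the start of the first `E`-free interval of length `L`, exists for
every `L`, and it tends to infinity with `L` because `E` is infinite. This sequence depends on `E`
alone, yet each of the two substitutions determines its asymptotics.

At the last level `n` at which no block contains a free interval of length `L`, the first gap must
run past the end of the block in which it starts, so it starts where the maximal free suffix of that
block starts (`firstGap_eq_suffixStart`). The index of this block is bounded, and free suffixes have
a scaling limit (`exists_suffixStart_limit`). Hence the first gap lies asymptotically at `d * s^[n]
1` with finitely many possible `d` (`firstGap_profile`). Consecutive gap positions have bounded
ratio (`firstGap_succ_le`), so they occur at every scale. By pigeonhole, two scales share the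
constant `d` for both substitutions; the ratio of the corresponding positions then tends both to a
positive power of `α` and to a positive power of `β` (`exists_pow_eq_pow_of_profiles`), against
independence.

The scaling limits come from Perron–Frobenius theory without irreducibility. The leading Jordan
terms of `|σⁿ(a)|` can oscillate only with root-of-unity phases, by positivity (`norm_coeff_le`,
`exists_pow_eq_one_of_dominated`). Along multiples of a common period the lengths therefore have
limiting ratios (`exists_growth_ratio`). -/

open Filter Topology

namespace CobhamSubst

/-! ### Self-similar cuttings of a sequence -/

/-- The positions `s k` cut the sequence `Y` into consecutive blocks `Y [s k, s (k + 1))`, the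
block with index `k` being determined by the letter `Y k`. -/
structure SelfSimilar {Q : Type*} (s : ℕ → ℕ) (Y : ℕ → Q) : Prop where
  mono : StrictMono s
  zero : s 0 = 0
  len : ∀ j k, Y j = Y k → s (j + 1) + s k = s (k + 1) + s j
  eq : ∀ j k r, Y j = Y k → s j + r < s (j + 1) → Y (s j + r) = Y (s k + r)

theorem exists_block {s : ℕ → ℕ} (hs : StrictMono s) (h0 : s 0 = 0) (n : ℕ) :
    ∃ k, s k ≤ n ∧ n < s (k + 1) := by
  induction n with
  | zero => exact ⟨0, by omega, by have := hs (Nat.lt_add_one 0); omega⟩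
  | succ n ih =>
    obtain ⟨k, h1, h2⟩ := ih
    by_cases h : n + 1 < s (k + 1)
    · exact ⟨k, by omega, h⟩
    · exact ⟨k + 1, by omega, by have := hs (Nat.lt_add_one (k + 1)); omega⟩

namespace SelfSimilar

variable {Q : Type*} {s t : ℕ → ℕ} {Y : ℕ → Q}

theorem window_len (h : SelfSimilar s Y) {j k l : ℕ} (hY : ∀ r < l, Y (j + r) = Y (k + r)) :
    s (j + l) + s k = s (k + l) + s j := by
  induction l with
  | zero => simp [add_comm]
  | succ l ih =>
    have h1 := ih fun r hr => hY r (by omega)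
    have h2 := h.len _ _ (hY l (by omega))
    simp only [← add_assoc]
    omega

theorem window_eq (h : SelfSimilar s Y) {j k l : ℕ} (hY : ∀ r < l, Y (j + r) = Y (k + r)) {r : ℕ}
    (hr : s j + r < s (j + l)) : Y (s j + r) = Y (s k + r) := by
  induction l with
  | zero => simp at hr
  | succ l ih =>
    by_cases hl : s j + r < s (j + l)
    · exact ih (fun r hr => hY r (by omega)) hl
    · have h1 := h.window_len (l := l) fun r hr => hY r (by omega)
      have h2 := h.eq _ _ (s j + r - s (j + l)) (hY l (by omega)) (by
        simp only [← add_assoc] at hr; omega)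
      have e1 : s (j + l) + (s j + r - s (j + l)) = s j + r := by omega
      have e2 : s (k + l) + (s j + r - s (j + l)) = s k + r := by omega
      rwa [e1, e2] at h2

theorem comp (ht : SelfSimilar t Y) (hs : SelfSimilar s Y) : SelfSimilar (t ∘ s) Y := by
  have key : ∀ j k, Y j = Y k → ∀ r < s (j + 1) - s j, Y (s j + r) = Y (s k + r) :=
    fun j k hjk r hr => hs.eq j k r hjk (by omega)
  have hlen : ∀ j k, Y j = Y k → s k + (s (j + 1) - s j) = s (k + 1) := by
    intro j k hjk
    have h1 := hs.len _ _ hjk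
    have h2 := hs.mono (Nat.lt_add_one j)
    have h3 := hs.mono (Nat.lt_add_one k)
    omega
  have hlen' : ∀ j, s j + (s (j + 1) - s j) = s (j + 1) := fun j => hlen j j rfl
  refine ⟨ht.mono.comp hs.mono, by simp [hs.zero, ht.zero], fun j k hjk => ?_,
    fun j k r hjk hr => ?_⟩
  · have := ht.window_len (key j k hjk)
    rwa [hlen' j, hlen j k hjk] at this
  · refine ht.window_eq (key j k hjk) ?_
    rwa [hlen' j]

theorem refl (Y : ℕ → Q) : SelfSimilar id Y := by
  refine ⟨strictMono_id, rfl, fun j k _ => by simp; omega, fun j k r hjk hr => ?_⟩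
  obtain rfl : r = 0 := by simp at hr; omega
  simpa using hjk

theorem iterate (h : SelfSimilar s Y) (n : ℕ) : SelfSimilar s^[n] Y := by
  induction n with
  | zero => exact refl Y
  | succ n ih => exact ih.comp h

/-- Recoding by windows makes the occurrences of a word a letter-determined set. The image of a
window of `l + 1` letters reaches at least `l` positions past the image of its first letter, so it
determines every window starting in that first image. -/
theorem blocks (h : SelfSimilar s Y) (l : ℕ) :
    SelfSimilar s (fun k (i : Fin (l + 1)) => Y (k + i)) := by
  have key : ∀ j k, (fun i : Fin (l + 1) => Y (j + i)) = (fun i : Fin (l + 1) => Y (k + i)) →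
      ∀ r < l + 1, Y (j + r) = Y (k + r) := fun j k hjk r hr => congrFun hjk ⟨r, hr⟩
  refine ⟨h.mono, h.zero, fun j k hjk => h.len j k (key j k hjk 0 (by omega)),
    fun j k r hjk hr => ?_⟩
  funext ⟨i, hi⟩
  simp only [add_assoc]
  refine h.window_eq (key j k hjk) ?_
  have := h.mono.add_le_nat l (j + 1)
  have e : l + (j + 1) = j + (l + 1) := by omega
  rw [e] at this
  omega

/-- Forgets the alphabet: with all letters distinct the conditions on equal letters are void. Two
cuttings over different alphabets can then be treated by one argument. -/
theorem id (h : SelfSimilar s Y) : SelfSimilar s (id : ℕ → ℕ) := by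
  refine ⟨h.mono, h.zero, ?_, ?_⟩
  · rintro j k rfl
    rfl
  · rintro j k r rfl -
    rfl

theorem le_apply (h : SelfSimilar s Y) (n : ℕ) : n ≤ s n := h.mono.le_apply

/-- Finitely many letters: every letter already occurs before a fixed position. -/
theorem exists_rep [Finite Q] (Y : ℕ → Q) : ∃ N, ∀ k, ∃ j < N, Y j = Y k := by
  classical
  have hf : (Set.range Y).Finite := Set.toFinite _
  choose! g hg using fun q (hq : q ∈ Set.range Y) => hq
  obtain ⟨N, hN⟩ := (hf.image g).bddAbove
  refine ⟨N + 1, fun k => ⟨g (Y k), ?_, hg _ ⟨k, rfl⟩⟩⟩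
  have := hN ⟨Y k, ⟨k, rfl⟩, rfl⟩
  omega

theorem exists_len_le [Finite Q] (h : SelfSimilar s Y) : ∃ M, ∀ k, s (k + 1) ≤ s k + M := by
  obtain ⟨N, hN⟩ := exists_rep Y
  refine ⟨s N, fun k => ?_⟩
  obtain ⟨j, hj, hjk⟩ := hN k
  have h1 := h.len _ _ hjk
  have h2 : s (j + 1) ≤ s N := h.mono.monotone hj
  omega

end SelfSimilar

theorem add_le_of_len_le {s : ℕ → ℕ} {M : ℕ} (h : ∀ k, s (k + 1) ≤ s k + M) (k r : ℕ) :
    s (k + r) ≤ s k + M * r := by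
  induction r with
  | zero => simp
  | succ r ih => have := h (k + r); rw [← add_assoc, mul_add]; omega

theorem le_add_of_le_len {s : ℕ → ℕ} {M : ℕ} (h : ∀ k, s k + M ≤ s (k + 1)) (k r : ℕ) :
    s k + M * r ≤ s (k + r) := by
  induction r with
  | zero => simp
  | succ r ih => have := h (k + r); rw [← add_assoc, mul_add]; omega

/-! ### Blocks that meet the set of occurrences -/

/-- The indices of the blocks that meet `E`. -/
def hitSet (s : ℕ → ℕ) (E : Set ℕ) : Set ℕ := {k | ∃ i ∈ E, s k ≤ i ∧ i < s (k + 1)}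

/-- Membership in `E` depends on the letter of `Y` only. -/
def LetterDetermined {Q : Type*} (Y : ℕ → Q) (E : Set ℕ) : Prop :=
  ∀ j k, Y j = Y k → j ∈ E → k ∈ E

section hitSet

variable {Q : Type*} {s t : ℕ → ℕ} {Y : ℕ → Q} {E : Set ℕ}

theorem hitSet_comp (ht : StrictMono t) (ht0 : t 0 = 0) (s : ℕ → ℕ) (E : Set ℕ) :
    hitSet (t ∘ s) E = hitSet s (hitSet t E) := by
  ext k
  constructor
  · rintro ⟨i, hi, h1, h2⟩
    obtain ⟨j, hj1, hj2⟩ := exists_block ht ht0 i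
    refine ⟨j, ⟨i, hi, hj1, hj2⟩, ?_, ?_⟩
    · have := ht.lt_iff_lt.1 (lt_of_le_of_lt h1 hj2); omega
    · exact ht.lt_iff_lt.1 (lt_of_le_of_lt hj1 h2)
  · rintro ⟨j, ⟨i, hi, hj1, hj2⟩, h1, h2⟩
    exact ⟨i, hi, (ht.monotone h1).trans hj1, hj2.trans_le (ht.monotone (by omega))⟩

theorem LetterDetermined.hitSet (hE : LetterDetermined Y E) (h : SelfSimilar s Y) :
    LetterDetermined Y (hitSet s E) := by
  rintro j k hjk ⟨i, hi, h1, h2⟩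
  have h3 := h.eq j k (i - s j) hjk (by omega)
  have h4 := h.len j k hjk
  rw [show s j + (i - s j) = i by omega] at h3
  exact ⟨_, hE _ _ h3 hi, by omega, by omega⟩

/-- After passing to a power, taking the set of hit blocks is idempotent on `E`. -/
theorem exists_iterate_hitSet_idem [Finite Q] (h : SelfSimilar s Y) (hE : LetterDetermined Y E) :
    ∃ P, 0 < P ∧ hitSet s^[P] (hitSet s^[P] E) = hitSet s^[P] E := by
  classical
  have hadd : ∀ m n, hitSet s^[n + m] E = hitSet s^[m] (hitSet s^[n] E) := fun m n => by
    rw [Function.iterate_add]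
    exact hitSet_comp (h.iterate n).mono (h.iterate n).zero _ E
  -- Each of these sets is a union of letter classes, so only finitely many of them occur and the
  -- sequence is eventually periodic.
  have himg : ∀ n, hitSet s^[n] E = Y ⁻¹' (Y '' hitSet s^[n] E) := fun n => by
    refine (Set.subset_preimage_image _ _).antisymm ?_
    rintro k ⟨j, hj, hjk⟩
    exact hE.hitSet (h.iterate n) j k hjk hj
  obtain ⟨i, j, hij, he⟩ := Finite.exists_ne_map_eq_of_infinite fun n => Y '' hitSet s^[n] E
  wlog hlt : i < j generalizing i j
  · exact this j i hij.symm he.symm (by omega)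
  have he' : hitSet s^[i] E = hitSet s^[j] E := by rw [himg i, himg j]; simp only [he]
  have hper : ∀ n, i ≤ n → hitSet s^[n + (j - i)] E = hitSet s^[n] E := fun n hn => by
    have h1 := hadd (n - i) i
    have h2 := hadd (n - i) j
    rw [show i + (n - i) = n by omega] at h1
    rw [show j + (n - i) = n + (j - i) by omega] at h2
    rw [h1, h2, he']
  have hper' : ∀ m n, i ≤ n → hitSet s^[n + m * (j - i)] E = hitSet s^[n] E := fun m n hn => by
    induction m with
    | zero => simp
    | succ m ih => rw [add_mul, one_mul, ← add_assoc, hper _ (by omega), ih]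
  -- A positive multiple of the period `j - i` that is also at least the preperiod `i`.
  refine ⟨(i + 1) * (j - i), Nat.mul_pos (by omega) (by omega), ?_⟩
  rw [← hadd, hper']
  nlinarith [show 1 ≤ j - i by omega]

theorem hitSet_iterate_of_idem (h : SelfSimilar s Y) (hid : hitSet s (hitSet s E) = hitSet s E)
    (n : ℕ) : hitSet s^[n + 1] E = hitSet s E := by
  induction n with
  | zero => simp
  | succ n ih =>
    rw [Function.iterate_succ, hitSet_comp (h.iterate _).mono (h.iterate _).zero, ih, hid]

end hitSet

/-! ### Free intervals and free suffixes of blocks -/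

/-- No element of `E` lies in the interval `[a, b)`. -/
def IsFree (E : Set ℕ) (a b : ℕ) : Prop := ∀ i, a ≤ i → i < b → i ∉ E

/-- The position of the first `E`-free interval of length `L`. -/
noncomputable def firstGap (E : Set ℕ) (L : ℕ) : ℕ := sInf {t | IsFree E t (t + L)}

/-- The start of the maximal `E`-free suffix of the interval `[s k, s (k + 1))`. -/
noncomputable def suffixStart (s : ℕ → ℕ) (E : Set ℕ) (k : ℕ) : ℕ :=
  sInf {t | s k ≤ t ∧ IsFree E t (s (k + 1))}

theorem IsFree.mono {E : Set ℕ} {a b a' b' : ℕ} (h : IsFree E a b) (ha : a ≤ a') (hb : b' ≤ b) :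
    IsFree E a' b' := fun i h1 h2 => h i (ha.trans h1) (h2.trans_le hb)

theorem exists_isFree {E : Set ℕ} (h : ¬ HasBoundedGaps E) (L : ℕ) : ∃ t, IsFree E t (t + L) := by
  simp only [HasBoundedGaps, not_exists, not_forall, not_and] at h
  obtain ⟨t, ht⟩ := h L
  exact ⟨t, fun i h1 h2 h3 => ht i h3 h1 h2⟩

theorem firstGap_isFree {E : Set ℕ} (h : ¬ HasBoundedGaps E) (L : ℕ) :
    IsFree E (firstGap E L) (firstGap E L + L) :=
  Nat.sInf_mem (s := {t | IsFree E t (t + L)}) (exists_isFree h L)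

theorem firstGap_le {E : Set ℕ} {L t : ℕ} (h : IsFree E t (t + L)) : firstGap E L ≤ t :=
  Nat.sInf_le h

theorem firstGap_tendsto {E : Set ℕ} (h : ¬ HasBoundedGaps E) (hE : E.Infinite) :
    Tendsto (firstGap E) atTop atTop := by
  refine tendsto_atTop.2 fun b => ?_
  obtain ⟨e, he, hbe⟩ := hE.exists_gt b
  filter_upwards [eventually_gt_atTop e] with L hL
  by_contra! hlt
  exact firstGap_isFree h L e (by omega) (by omega) he

section suffixStart

variable {s : ℕ → ℕ} {E : Set ℕ}

theorem suffixStart_mem (hs : StrictMono s) (k : ℕ) :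
    s k ≤ suffixStart s E k ∧ IsFree E (suffixStart s E k) (s (k + 1)) :=
  Nat.sInf_mem (s := {t | s k ≤ t ∧ IsFree E t (s (k + 1))})
    ⟨s (k + 1), (hs (Nat.lt_add_one k)).le, fun i h1 h2 => by omega⟩

theorem suffixStart_le {k t : ℕ} (h1 : s k ≤ t) (h2 : IsFree E t (s (k + 1))) :
    suffixStart s E k ≤ t := Nat.sInf_le ⟨h1, h2⟩

theorem suffixStart_le_succ (hs : StrictMono s) (k : ℕ) : suffixStart s E k ≤ s (k + 1) :=
  suffixStart_le (hs (Nat.lt_add_one k)).le fun i h1 h2 => by omega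

theorem suffixStart_of_not_hit (hs : StrictMono s) {k : ℕ} (h : k ∉ hitSet s E) :
    suffixStart s E k = s k :=
  (suffixStart_le le_rfl fun i h1 h2 h3 => h ⟨i, h3, h1, h2⟩).antisymm (suffixStart_mem hs k).1

/-- The free suffix of a block is that of its last sub-block that meets `E`. -/
theorem suffixStart_comp {t : ℕ → ℕ} (ht : StrictMono t) (ht0 : t 0 = 0) (hs : StrictMono s)
    {k h : ℕ}
    (hh : h ∈ hitSet t E) (h1 : s k ≤ h) (h2 : h < s (k + 1))
    (hmax : ∀ i, h < i → i < s (k + 1) → i ∉ hitSet t E) :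
    suffixStart (t ∘ s) E k = suffixStart t E h := by
  have hts := ht.comp hs
  have hfree : IsFree E (t (h + 1)) (t (s (k + 1))) := by
    intro i hi1 hi2 hiE
    obtain ⟨j, hj1, hj2⟩ := exists_block ht ht0 i
    have h3 := ht.lt_iff_lt.1 (lt_of_le_of_lt hi1 hj2)
    have h4 := ht.lt_iff_lt.1 (lt_of_le_of_lt hj1 hi2)
    exact hmax j (by omega) h4 ⟨i, hiE, hj1, hj2⟩
  apply le_antisymm
  · have h3 := suffixStart_mem (E := E) ht h
    refine suffixStart_le ((ht.monotone h1).trans h3.1) fun i hi1 hi2 => ?_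
    by_cases hi : i < t (h + 1)
    · exact h3.2 i hi1 hi
    · exact hfree i (by omega) hi2
  · have h3 := suffixStart_mem (E := E) hts k
    refine suffixStart_le ?_ (h3.2.mono le_rfl (ht.monotone h2))
    obtain ⟨i, hi, hi1, hi2⟩ := hh
    by_contra! hlt
    exact h3.2 i (by omega) (hi2.trans_le (ht.monotone h2)) hi

end suffixStart

/-! ### Scaling limits of the block boundaries -/

/-- The iterates of `s` have a scaling limit `c` with ratio `θ`, and all blocks grow. -/
structure HasScaling (s : ℕ → ℕ) (c : ℕ → ℝ) (θ : ℝ) : Prop where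
  lim : ∀ k, Tendsto (fun n => (s^[n] k : ℝ) / (s^[n] 1 : ℝ)) atTop (𝓝 (c k))
  ratio : Tendsto (fun n => (s^[n + 1] 1 : ℝ) / (s^[n] 1 : ℝ)) atTop (𝓝 θ)
  grow : ∀ B, ∃ N, ∀ n ≥ N, ∀ k, s^[n] k + B ≤ s^[n] (k + 1)

namespace HasScaling

variable {Q : Type*} {s : ℕ → ℕ} {c : ℕ → ℝ} {θ : ℝ} {Y : ℕ → Q}

theorem iterate_one_pos (hs : SelfSimilar s Y) (n : ℕ) : (0 : ℝ) < (s^[n] 1 : ℝ) := by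
  have := (hs.iterate n).le_apply 1
  exact_mod_cast this

theorem ratio_pow (h : HasScaling s c θ) (hs : SelfSimilar s Y) (m : ℕ) :
    Tendsto (fun n => (s^[n + m] 1 : ℝ) / (s^[n] 1 : ℝ)) atTop (𝓝 (θ ^ m)) := by
  induction m with
  | zero =>
    refine tendsto_const_nhds.congr fun n => ?_
    have := iterate_one_pos hs n
    simp [div_self this.ne']
  | succ m ih =>
    have h1 := (h.ratio.comp (tendsto_add_atTop_nat m)).mul ih
    rw [pow_succ']
    refine h1.congr fun n => ?_
    have := iterate_one_pos hs (n + m)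
    have := iterate_one_pos hs n
    simp only [Function.comp_apply]
    rw [show n + (m + 1) = n + m + 1 by omega]
    field_simp

theorem pow (h : HasScaling s c θ) (hs : SelfSimilar s Y) {P : ℕ} (hP : 0 < P) :
    HasScaling s^[P] c (θ ^ P) := by
  have ht : Tendsto (fun n => P * n) atTop atTop := tendsto_id.const_mul_atTop' hP
  refine ⟨fun k => ?_, ?_, fun B => ?_⟩
  · simp only [← Function.iterate_mul]
    exact (h.lim k).comp ht
  · simp only [← Function.iterate_mul]
    exact (h.ratio_pow hs P).comp ht
  · obtain ⟨N, hN⟩ := h.grow B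
    refine ⟨N, fun n hn k => ?_⟩
    rw [← Function.iterate_mul]
    exact hN _ (by nlinarith) k

/-- At some level `N` every block has length at least 2, so `N` further levels at least double
`s^[n] 1`, giving `2 ≤ θ ^ N`. -/
theorem one_lt (h : HasScaling s c θ) (hs : SelfSimilar s Y) : 1 < θ := by
  obtain ⟨N, hN⟩ := h.grow 2
  have hθ : 0 ≤ θ := ge_of_tendsto' h.ratio fun n => by positivity
  have h2 : (2 : ℝ) ≤ θ ^ N := by
    refine ge_of_tendsto' (h.ratio_pow hs N) fun n => ?_
    rw [le_div_iff₀ (iterate_one_pos hs n)]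
    have := le_add_of_le_len (hN N le_rfl) 0 (s^[n] 1)
    rw [(hs.iterate N).zero, zero_add, zero_add, ← Function.iterate_add_apply, add_comm] at this
    exact_mod_cast this
  by_contra! hle
  linarith [pow_le_one₀ (n := N) hθ hle]

theorem limit_one (h : HasScaling s c θ) (hs : SelfSimilar s Y) : c 1 = 1 := by
  refine tendsto_nhds_unique (h.lim 1) (tendsto_const_nhds.congr fun n => ?_)
  have := iterate_one_pos hs n
  simp [div_self this.ne']

theorem limit_mono (h : HasScaling s c θ) (hs : SelfSimilar s Y) : Monotone c := by
  intro j k hjk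
  refine le_of_tendsto_of_tendsto' (h.lim j) (h.lim k) fun n => ?_
  have : s^[n] j ≤ s^[n] k := (hs.iterate n).mono.monotone hjk
  gcongr

theorem limit_nonneg (h : HasScaling s c θ) (k : ℕ) : 0 ≤ c k :=
  ge_of_tendsto' (h.lim k) fun n => by positivity

theorem limit_iterate_one (h : HasScaling s c θ) (hs : SelfSimilar s Y) (m : ℕ) :
    c (s^[m] 1) = θ ^ m := by
  refine tendsto_nhds_unique (h.lim _) ((h.ratio_pow hs m).congr fun n => ?_)
  rw [Function.iterate_add_apply]

theorem exists_lt_limit (h : HasScaling s c θ) (hs : SelfSimilar s Y) (b : ℝ) : ∃ k, b < c k := by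
  obtain ⟨m, hm⟩ := pow_unbounded_of_one_lt b (h.one_lt hs)
  exact ⟨s^[m] 1, by rwa [h.limit_iterate_one hs]⟩

/-- The increment `c (k + 1) - c k` is the limiting length of a block and depends only on the letter
`Y k`, so it takes finitely many values. -/
theorem limit_succ_le [Finite Q] (h : HasScaling s c θ) (hs : SelfSimilar s Y) :
    ∃ C, 0 < C ∧ ∀ k, c (k + 1) ≤ c k + C := by
  obtain ⟨N, hN⟩ := SelfSimilar.exists_rep Y
  refine ⟨c N + 1, by linarith [h.limit_nonneg N], fun k => ?_⟩
  obtain ⟨j, hj, hjk⟩ := hN k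
  have h1 : c (k + 1) - c k = c (j + 1) - c j := by
    refine tendsto_nhds_unique ((h.lim _).sub (h.lim _))
      (((h.lim _).sub (h.lim _)).congr fun n => ?_)
    have := (hs.iterate n).len _ _ hjk
    have h2 : (s^[n] (j + 1) : ℝ) + s^[n] k = s^[n] (k + 1) + s^[n] j := by exact_mod_cast this
    rw [← sub_div, ← sub_div]
    congr 1
    linarith
  have h2 := h.limit_mono hs (show j + 1 ≤ N from hj)
  linarith [h.limit_nonneg j]

/-- Level `n - m` positions, rescaled at level `n`. -/
theorem lim_shift (h : HasScaling s c θ) (hs : SelfSimilar s Y) (k m : ℕ) :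
    Tendsto (fun n => (s^[n] k : ℝ) / (s^[n + m] 1 : ℝ)) atTop (𝓝 (c k / θ ^ m)) := by
  have hθ := (zero_lt_one.trans (h.one_lt hs)).ne'
  refine ((h.lim k).div (h.ratio_pow hs m) (pow_ne_zero _ hθ)).congr fun n => ?_
  have := iterate_one_pos hs (n + m)
  have := iterate_one_pos hs n
  simp only [Pi.div_apply]
  field_simp

end HasScaling

theorem exists_tendsto_of_forall_eventually_close {a : ℕ → ℝ}
    (h : ∀ ε > 0, ∃ x, ∀ᶠ n in atTop, |a n - x| < ε) : ∃ d, Tendsto a atTop (𝓝 d) := by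
  refine cauchySeq_tendsto_of_complete (Metric.cauchySeq_iff.2 fun ε hε => ?_)
  obtain ⟨x, hx⟩ := h (ε / 2) (by linarith)
  obtain ⟨N, hN⟩ := eventually_atTop.1 hx
  refine ⟨N, fun m hm n hn => ?_⟩
  have h1 := abs_lt.1 (hN m hm)
  have h2 := abs_lt.1 (hN n hn)
  rw [Real.dist_eq, abs_lt]
  constructor <;> linarith

/-! ### Asymptotic position of the first long gap -/

section Gaps

variable {Q : Type*} {s : ℕ → ℕ} {c : ℕ → ℝ} {θ : ℝ} {Y : ℕ → Q} {E : Set ℕ}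

/-- The point is that `k'` does not depend on `n`. By idempotence the hit indices are the same at
every level `≥ 1`, so descending `m` times to the last hit sub-block follows the same indices for
all `n`. A block that is not hit is its own free suffix. -/
theorem suffixStart_iterate_bounds (hs : SelfSimilar s Y)
    (hid : hitSet s (hitSet s E) = hitSet s E) (m k : ℕ) :
    ∃ k', ∀ n, 1 ≤ n → s^[n] k' ≤ suffixStart s^[n + m] E k ∧
      suffixStart s^[n + m] E k ≤ s^[n] (k' + 1) := by
  classical
  induction m generalizing k with
  | zero => exact ⟨k, fun n _ => ⟨(suffixStart_mem (hs.iterate n).mono k).1,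
      suffixStart_le_succ (hs.iterate n).mono k⟩⟩
  | succ m ih =>
    by_cases hk : k ∈ hitSet s E
    · have hk' := hk
      rw [← hid] at hk'
      obtain ⟨i, hi, hi1, hi2⟩ := hk'
      let P : ℕ → Prop := fun j => j ∈ hitSet s E ∧ s k ≤ j ∧ j < s (k + 1)
      have hP : P (Nat.findGreatest P (s (k + 1))) :=
        Nat.findGreatest_spec hi2.le ⟨hi, hi1, hi2⟩
      set g := Nat.findGreatest P (s (k + 1)) with hg
      obtain ⟨k', hk'⟩ := ih g
      refine ⟨k', fun n hn => ?_⟩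
      have hit : hitSet s^[n + m] E = hitSet s E := by
        obtain ⟨l, rfl⟩ : ∃ l, n = l + 1 := ⟨n - 1, by omega⟩
        rw [show l + 1 + m = l + m + 1 by omega]
        exact hitSet_iterate_of_idem hs hid _
      have : suffixStart s^[n + (m + 1)] E k = suffixStart s^[n + m] E g := by
        rw [← add_assoc, Function.iterate_succ]
        refine suffixStart_comp (hs.iterate _).mono (hs.iterate _).zero hs.mono
          (by rw [hit]; exact hP.1) hP.2.1 hP.2.2 fun j hj1 hj2 hj3 => ?_
        rw [hit] at hj3
        have : j ≤ g := Nat.le_findGreatest hj2.le ⟨hj3, by have := hP.2.1; omega, hj2⟩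
        omega
      rw [this]
      exact hk' n hn
    · refine ⟨s^[m + 1] k, fun n hn => ?_⟩
      have hit : k ∉ hitSet s^[n + (m + 1)] E := by
        rw [← add_assoc, hitSet_iterate_of_idem hs hid]
        exact hk
      rw [suffixStart_of_not_hit (hs.iterate _).mono hit, Function.iterate_add_apply s n (m + 1)]
      exact ⟨le_rfl, (hs.iterate n).mono.monotone (by omega)⟩

/-- `suffixStart_iterate_bounds` confines the rescaled position to an interval whose limiting width
is at most `C / θ ^ m`; since `m` is arbitrary, the sequence is Cauchy. -/
theorem exists_suffixStart_limit [Finite Q] (h : HasScaling s c θ) (hs : SelfSimilar s Y)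
    (hid : hitSet s (hitSet s E) = hitSet s E) (k : ℕ) :
    ∃ d, Tendsto (fun n => (suffixStart s^[n] E k : ℝ) / (s^[n] 1 : ℝ)) atTop (𝓝 d) := by
  refine exists_tendsto_of_forall_eventually_close fun ε hε => ?_
  obtain ⟨C, hC, hCk⟩ := h.limit_succ_le hs
  have hθ := h.one_lt hs
  obtain ⟨m, hm⟩ := pow_unbounded_of_one_lt (C / (ε / 2)) hθ
  have hθm : 0 < θ ^ m := by positivity
  obtain ⟨k', hk'⟩ := suffixStart_iterate_bounds hs hid m k
  have h1 := h.lim_shift hs k' m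
  have h2 := h.lim_shift hs (k' + 1) m
  have h3 : c (k' + 1) / θ ^ m < c k' / θ ^ m + ε / 2 := by
    rw [div_lt_iff₀ (by linarith)] at hm
    rw [← sub_lt_iff_lt_add', ← sub_div, div_lt_iff₀ hθm]
    linarith [hCk k']
  refine ⟨c k' / θ ^ m, ?_⟩
  rw [← map_add_atTop_eq_nat m, eventually_map]
  filter_upwards [h1.eventually_const_lt (show c k' / θ ^ m - ε < _ by linarith),
    h2.eventually_lt_const (show _ < c k' / θ ^ m + ε by linarith), eventually_ge_atTop 1]
    with n hn1 hn2 hn3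
  obtain ⟨h4, h5⟩ := hk' n hn3
  have hpos := HasScaling.iterate_one_pos hs (n + m)
  have h6 : (s^[n] k' : ℝ) / (s^[n + m] 1 : ℝ) ≤ (suffixStart s^[n + m] E k : ℝ) / s^[n + m] 1 := by
    gcongr
  have h7 : (suffixStart s^[n + m] E k : ℝ) / s^[n + m] 1 ≤
      (s^[n] (k' + 1) : ℝ) / (s^[n + m] 1 : ℝ) := by
    gcongr
  rw [abs_lt]
  constructor <;> linarith

end Gaps

section Gaps

variable {Q : Type*} {s : ℕ → ℕ} {c : ℕ → ℝ} {θ : ℝ} {Y : ℕ → Q} {E : Set ℕ}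

theorem isFree_iterate_of_not_hit (hs : SelfSimilar s Y)
    (hid : hitSet s (hitSet s E) = hitSet s E) {k l n : ℕ} (hn : 1 ≤ n)
    (h : ∀ i, k ≤ i → i < l → i ∉ hitSet s E) : IsFree E (s^[n] k) (s^[n] l) := by
  intro i hi1 hi2 hiE
  have hmono := (hs.iterate n).mono
  obtain ⟨j, hj1, hj2⟩ := exists_block hmono (hs.iterate n).zero i
  have h3 := hmono.lt_iff_lt.1 (lt_of_le_of_lt hi1 hj2)
  have h4 := hmono.lt_iff_lt.1 (lt_of_le_of_lt hj1 hi2)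
  refine h j (by omega) h4 ?_
  obtain ⟨m, rfl⟩ : ∃ m, n = m + 1 := ⟨n - 1, by omega⟩
  rw [← hitSet_iterate_of_idem hs hid m]
  exact ⟨i, hiE, hj1, hj2⟩

/-- A long free interval contains blocks, all of which miss `E`. -/
theorem exists_blocks_of_isFree (hs : SelfSimilar s Y) {M : ℕ} (hM : ∀ k, s (k + 1) ≤ s k + M)
    {t L : ℕ} (hf : IsFree E t (t + L)) :
    ∃ k l, k ≤ t + 1 ∧ (∀ i, k ≤ i → i < l → i ∉ hitSet s E) ∧ L < M * (l - k) + 2 * M + 1 := by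
  obtain ⟨k, hk1, hk2⟩ := exists_block hs.mono hs.zero t
  obtain ⟨l, hl1, hl2⟩ := exists_block hs.mono hs.zero (t + L)
  have hkt := hs.le_apply k
  refine ⟨k + 1, l, by omega, ?_, ?_⟩
  · rintro i hi1 hi2 ⟨e, he, he1, he2⟩
    have h1 : s (k + 1) ≤ s i := hs.mono.monotone hi1
    have h2 : s (i + 1) ≤ s l := hs.mono.monotone hi2
    exact hf e (by omega) (by omega) he
  · have h1 := hM k
    have h2 := hM l
    by_cases hkl : k + 1 ≤ l
    · have h3 := add_le_of_len_le hM (k + 1) (l - (k + 1))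
      rw [show k + 1 + (l - (k + 1)) = l by omega] at h3
      omega
    · have : s (l + 1) ≤ s (k + 1) := hs.mono.monotone (by omega)
      omega

theorem exists_not_hit [Finite Q] (hs : SelfSimilar s Y) (hgap : ¬ HasBoundedGaps E) :
    ∃ k, k ∉ hitSet s E := by
  obtain ⟨M, hM⟩ := hs.exists_len_le
  obtain ⟨t, ht⟩ := exists_isFree hgap (2 * M + 1)
  obtain ⟨k, l, -, h, hL⟩ := exists_blocks_of_isFree hs hM ht
  have hkl : k < l := by
    by_contra! hle
    rw [Nat.sub_eq_zero_of_le hle] at hL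
    omega
  exact ⟨k, h k le_rfl hkl⟩

/-- The blocks lying inside a gap of length `L` have images under `s^[N]` that are again free. With
`N` chosen so that each image has length at least `2 * M`, these images cover more than `L`
positions once `L ≥ 4 * M + 1`, the two partial end blocks being accounted for. Their start is at
most a constant multiple of the old one. -/
theorem firstGap_succ_le [Finite Q] (h : HasScaling s c θ) (hs : SelfSimilar s Y)
    (hid : hitSet s (hitSet s E) = hitSet s E) (hE : E.Infinite) (hgap : ¬ HasBoundedGaps E) :
    ∃ K, ∀ᶠ L in atTop, firstGap E (L + 1) ≤ K * firstGap E L := by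
  obtain ⟨M, hM⟩ := hs.exists_len_le
  obtain ⟨N', hN'⟩ := h.grow (2 * M)
  obtain ⟨N, hN, hN1⟩ : ∃ N, (∀ k, s^[N] k + 2 * M ≤ s^[N] (k + 1)) ∧ 1 ≤ N :=
    ⟨N' + 1, hN' _ (by omega), by omega⟩
  obtain ⟨R, hR⟩ := (hs.iterate N).exists_len_le
  refine ⟨2 * R, ?_⟩
  filter_upwards [eventually_ge_atTop (4 * M + 1),
    (firstGap_tendsto hgap hE).eventually_ge_atTop 1] with L hL hL1
  obtain ⟨k, l, hk, hkl, hlen⟩ := exists_blocks_of_isFree hs hM (firstGap_isFree hgap L)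
  have hle : k ≤ l := by
    by_contra! hlt
    rw [Nat.sub_eq_zero_of_le hlt.le] at hlen
    omega
  have hfree := isFree_iterate_of_not_hit hs hid hN1 hkl
  have h1 := le_add_of_le_len hN k (l - k)
  rw [show k + (l - k) = l by omega, mul_assoc] at h1
  have h2 := firstGap_le (hfree.mono le_rfl (show s^[N] k + (L + 1) ≤ _ by omega))
  have h3 : s^[N] k ≤ s^[N] (firstGap E L + 1) := (hs.iterate N).mono.monotone hk
  have h4 := add_le_of_len_le hR 0 (firstGap E L + 1)
  rw [(hs.iterate N).zero, zero_add, zero_add] at h4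
  calc firstGap E (L + 1) ≤ R * (firstGap E L + 1) := by omega
    _ ≤ R * (2 * firstGap E L) := Nat.mul_le_mul_left _ (by omega)
    _ = 2 * R * firstGap E L := by ring

/-- Some level `n` block contains a free interval of length `L`. -/
def BlockHasGap (s : ℕ → ℕ) (E : Set ℕ) (L n : ℕ) : Prop :=
  ∃ k t, s^[n] k ≤ t ∧ t + L ≤ s^[n] (k + 1) ∧ IsFree E t (t + L)

theorem exists_blockHasGap [Finite Q] (h : HasScaling s c θ) (hs : SelfSimilar s Y)
    (hid : hitSet s (hitSet s E) = hitSet s E) (hgap : ¬ HasBoundedGaps E) (L : ℕ) :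
    ∃ n, BlockHasGap s E L n := by
  obtain ⟨k, hk⟩ := exists_not_hit hs hgap
  obtain ⟨N, hN⟩ := h.grow L
  have hfree : IsFree E (s^[N + 1] k) (s^[N + 1] (k + 1)) :=
    isFree_iterate_of_not_hit hs hid (by omega) fun i h1 h2 => by
      obtain rfl : i = k := by omega
      exact hk
  have := hN (N + 1) (by omega) k
  exact ⟨N + 1, k, s^[N + 1] k, le_rfl, this, hfree.mono le_rfl this⟩

/-- The gap is carried into the block of an earlier index with the same letter. -/
theorem firstGap_le_of_blockHasGap (hs : SelfSimilar s Y) (hdet : LetterDetermined Y E) {N : ℕ}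
    (hN : ∀ k, ∃ j < N, Y j = Y k) {L n : ℕ} (hB : BlockHasGap s E L n) :
    firstGap E L ≤ s^[n] N := by
  obtain ⟨k, t, h1, h2, hf⟩ := hB
  obtain ⟨j, hj, hjk⟩ := hN k
  have hn := hs.iterate n
  have hlen := hn.len j k hjk
  have hjN : s^[n] (j + 1) ≤ s^[n] N := hn.mono.monotone hj
  have : IsFree E (t - s^[n] k + s^[n] j) (t - s^[n] k + s^[n] j + L) := by
    intro i hi1 hi2 hiE
    have he := hn.eq j k (i - s^[n] j) hjk (by omega)
    rw [show s^[n] j + (i - s^[n] j) = i by omega] at he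
    exact hf _ (by omega) (by omega) (hdet _ _ he hiE)
  have := firstGap_le this
  omega

/-- The first gap cannot fit in its block, so it reaches the block's end. Prolonging it to the left
over the whole free suffix keeps it free, and minimality excludes an earlier start. -/
theorem firstGap_eq_suffixStart (hgap : ¬ HasBoundedGaps E) {L n k : ℕ}
    (hB : ¬ BlockHasGap s E L n) (h1 : s^[n] k ≤ firstGap E L)
    (h2 : firstGap E L < s^[n] (k + 1)) (hs : SelfSimilar s Y) :
    firstGap E L = suffixStart s^[n] E k := by
  have hf := firstGap_isFree hgap L
  have h3 : s^[n] (k + 1) ≤ firstGap E L + L := by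
    by_contra! hlt
    exact hB ⟨k, _, h1, hlt.le, hf⟩
  refine le_antisymm ?_ (suffixStart_le h1 (hf.mono le_rfl h3))
  have h4 := suffixStart_mem (E := E) (hs.iterate n).mono k
  by_contra! hlt
  have : IsFree E (suffixStart s^[n] E k) (suffixStart s^[n] E k + L) := by
    intro i hi1 hi2
    by_cases hi : i < s^[n] (k + 1)
    · exact h4.2 i hi1 hi
    · exact hf i (by omega) (by omega)
  have := firstGap_le this
  omega

/-- Only block 0 could have limit 0. It contains, at high levels, an element of `E` beyond `s^[n]
1`, because some index `j ≥ 1` is hit at every level `n ≥ 1`. -/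
theorem suffixStart_limit_pos (h : HasScaling s c θ) (hs : SelfSimilar s Y)
    (hid : hitSet s (hitSet s E) = hitSet s E) (hE : E.Infinite) {k : ℕ} {d : ℝ}
    (hd : Tendsto (fun n => (suffixStart s^[n] E k : ℝ) / (s^[n] 1 : ℝ)) atTop (𝓝 d)) :
    0 < d := by
  have hθ := h.one_lt hs
  obtain ⟨e, he, hlt⟩ := hE.exists_gt (s 1)
  obtain ⟨j, hj1, hj2⟩ := exists_block hs.mono hs.zero e
  have hj : 1 ≤ j := by
    have := hs.mono.lt_iff_lt.1 (hlt.trans hj2); omega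
  obtain ⟨m, hm⟩ : ∃ m, j < s^[m] 1 := by
    obtain ⟨m, hm⟩ := h.grow (j + 1)
    have := hm m le_rfl 0
    rw [zero_add] at this
    exact ⟨m, by omega⟩
  have key : ∀ n, 1 ≤ n → s^[n] 1 ≤ suffixStart s^[n + m] E k := by
    intro n hn
    have hmem := suffixStart_mem (E := E) (hs.iterate (n + m)).mono k
    by_cases hk : 1 ≤ k
    · refine le_trans ?_ hmem.1
      rw [Function.iterate_add_apply]
      exact (hs.iterate n).mono.monotone (hk.trans ((hs.iterate m).le_apply k))
    · obtain rfl : k = 0 := by omega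
      have hit : j ∈ hitSet s^[n] E := by
        obtain ⟨l, rfl⟩ : ∃ l, n = l + 1 := ⟨n - 1, by omega⟩
        rw [hitSet_iterate_of_idem hs hid]
        exact ⟨e, he, hj1, hj2⟩
      obtain ⟨i, hi, hi1, hi2⟩ := hit
      by_contra! hlt'
      have h1 : s^[n] 1 ≤ s^[n] j := (hs.iterate n).mono.monotone hj
      refine hmem.2 i (by omega) (hi2.trans_le ?_) hi
      rw [Function.iterate_add_apply s n m (0 + 1)]
      exact (hs.iterate n).mono.monotone hm
  have h1 := h.lim_shift hs 1 m
  rw [h.limit_one hs] at h1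
  have hle : 1 / θ ^ m ≤ d := by
    refine le_of_tendsto_of_tendsto h1 (hd.comp (tendsto_add_atTop_nat m)) ?_
    filter_upwards [eventually_ge_atTop 1] with n hn
    have := key n hn
    simp only [Function.comp_apply]
    gcongr
  exact lt_of_lt_of_le (by positivity) hle

/-- The positions of the first gaps are asymptotically of the form `d (κ L) * s^[ν L] 1`, where
`κ L` takes finitely many values. -/
theorem firstGap_profile [Finite Q] (h : HasScaling s c θ) (hs : SelfSimilar s Y)
    (hid : hitSet s (hitSet s E) = hitSet s E) (hdet : LetterDetermined Y E) (hE : E.Infinite)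
    (hgap : ¬ HasBoundedGaps E) :
    ∃ (J : ℕ) (d : ℕ → ℝ) (κ ν : ℕ → ℕ), (∀ k, 0 < d k) ∧ (∀ᶠ L in atTop, κ L < J) ∧
      Tendsto ν atTop atTop ∧
      Tendsto (fun L => (firstGap E L : ℝ) / (s^[ν L] 1 : ℝ) - d (κ L)) atTop (𝓝 0) := by
  classical
  have hex := exists_blockHasGap h hs hid hgap
  -- The last level before a block first holds a gap of length `L`. The subtraction is genuine for
  -- large `L`, when level 0 holds no such gap.
  let ν : ℕ → ℕ := fun L => Nat.find (hex L) - 1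
  have hsmall : ∀ n, ∀ᶠ L in atTop, ¬ BlockHasGap s E L n := by
    intro n
    obtain ⟨M, hM⟩ := (hs.iterate n).exists_len_le
    filter_upwards [eventually_gt_atTop M] with L hL
    rintro ⟨k, t, h1, h2, -⟩
    have := hM k
    omega
  have hfind : ∀ n, ∀ᶠ L in atTop, n < Nat.find (hex L) := by
    intro n
    have : ∀ᶠ L in atTop, ∀ m ∈ Finset.range (n + 1), ¬ BlockHasGap s E L m :=
      (eventually_all_finset _).2 fun m _ => hsmall m
    filter_upwards [this] with L hL
    by_contra! hle
    exact hL _ (Finset.mem_range.2 (by omega)) (Nat.find_spec (hex L))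
  have hν : Tendsto ν atTop atTop := by
    refine tendsto_atTop.2 fun n => ?_
    filter_upwards [hfind n] with L hL
    simp only [ν]
    omega
  choose κ hκ using fun L => exists_block (hs.iterate (ν L)).mono (hs.iterate (ν L)).zero
    (firstGap E L)
  choose d hd using exists_suffixStart_limit h hs hid
  obtain ⟨N, hN⟩ := SelfSimilar.exists_rep Y
  have hlim : Tendsto (fun n => (s^[n + 1] N : ℝ) / (s^[n] 1 : ℝ)) atTop (𝓝 (c N * θ)) := by
    refine (((h.lim N).comp (tendsto_add_atTop_nat 1)).mul h.ratio).congr fun n => ?_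
    have := HasScaling.iterate_one_pos hs (n + 1)
    have := HasScaling.iterate_one_pos hs n
    simp only [Function.comp_apply]
    field_simp
  -- A gap inside a block of level `ν L + 1` bounds the first gap by `s^[ν L + 1] N`, which is about
  -- `c N * θ` times `s^[ν L] 1`. This lies below `s^[ν L] J`, so the block index stays below `J`.
  obtain ⟨J, hJ⟩ := h.exists_lt_limit hs (c N * θ)
  have hκJ : ∀ᶠ L in atTop, κ L < J := by
    filter_upwards [hν.eventually (hlim.eventually_lt (h.lim J) hJ), hfind 0] with L hL hL0
    have hpos := HasScaling.iterate_one_pos hs (ν L)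
    rw [div_lt_div_iff_of_pos_right hpos] at hL
    have h1 := firstGap_le_of_blockHasGap hs hdet hN (Nat.find_spec (hex L))
    rw [show Nat.find (hex L) = ν L + 1 by simp only [ν]; omega] at h1
    have h2 : s^[ν L + 1] N < s^[ν L] J := by exact_mod_cast hL
    exact (hs.iterate (ν L)).mono.lt_iff_lt.1 (by have := (hκ L).1; omega)
  refine ⟨J, d, κ, ν, fun k => suffixStart_limit_pos h hs hid hE (hd k), hκJ, hν, ?_⟩
  rw [Metric.tendsto_nhds]
  intro ε hε
  have hall : ∀ᶠ n in atTop, ∀ k ∈ Finset.range J,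
      dist ((suffixStart s^[n] E k : ℝ) / (s^[n] 1 : ℝ)) (d k) < ε :=
    (eventually_all_finset _).2 fun k _ => Metric.tendsto_nhds.1 (hd k) ε hε
  filter_upwards [hν.eventually hall, hκJ, hfind 0] with L hL hk hL0
  have hB : ¬ BlockHasGap s E L (ν L) := Nat.find_min (hex L) (by simp only [ν]; omega)
  have := hL (κ L) (by simpa using hk)
  rw [firstGap_eq_suffixStart hgap hB (hκ L).1 (hκ L).2 hs]
  simpa [Real.dist_eq] using this

end Gaps

/-! ### Comparison of two scalings along an ultrafilter -/

theorem exists_eventually_eq_of_lt {ι : Type*} (U : Ultrafilter ι) {f : ι → ℕ} {J : ℕ}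
    (h : ∀ᶠ i in (U : Filter ι), f i < J) : ∃ k < J, ∀ᶠ i in (U : Filter ι), f i = k := by
  have h1 : (⋃ k ∈ Set.Iio J, {i | f i = k}) ∈ U := by
    refine mem_of_superset h fun i hi => ?_
    simpa using hi
  rwa [Ultrafilter.finite_biUnion_mem_iff (Set.finite_Iio J)] at h1

/-- The bound `2 ≤ R` forces `m < n`, and `R ≤ B` bounds `n - m`. Along an ultrafilter the
difference is therefore a constant `k`, and `R` behaves like `s^[m + k] 1 / s^[m] 1`. -/
theorem exists_tendsto_theta_pow {Q ι : Type*} {s : ℕ → ℕ} {c : ℕ → ℝ} {θ : ℝ} {Y : ℕ → Q}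
    (h : HasScaling s c θ) (hs : SelfSimilar s Y) (U : Ultrafilter ι) {m n : ι → ℕ}
    (hm : Tendsto m U atTop) {R : ι → ℝ} {B : ℝ} (hR : ∀ᶠ i in (U : Filter ι), 2 ≤ R i ∧ R i ≤ B)
    (hlim : Tendsto (fun i => R i * (s^[m i] 1 : ℝ) / (s^[n i] 1 : ℝ)) U (𝓝 1)) :
    ∃ k, 0 < k ∧ Tendsto R U (𝓝 (θ ^ k)) := by
  have hmono : Monotone fun n => (s^[n] 1 : ℝ) := by
    refine monotone_nat_of_le_succ fun n => ?_
    rw [Function.iterate_succ_apply]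
    exact_mod_cast (hs.iterate n).mono.monotone (hs.le_apply 1)
  have hpos := HasScaling.iterate_one_pos hs
  obtain ⟨M, hM⟩ := pow_unbounded_of_one_lt (2 * B) (h.one_lt hs)
  have hgt : ∀ᶠ i in (U : Filter ι), m i < n i := by
    filter_upwards [hR, hlim.eventually_lt_const (show (1 : ℝ) < 2 by norm_num)] with i hi hi2
    by_contra! hle
    rw [div_lt_iff₀ (hpos _)] at hi2
    have := hmono hle
    have := hpos (n i)
    simp only at *
    nlinarith
  have hlt : ∀ᶠ i in (U : Filter ι), n i - m i < M := by
    filter_upwards [hR, hlim.eventually_const_lt (show (1 / 2 : ℝ) < 1 by norm_num), hgt,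
      hm.eventually ((h.ratio_pow hs M).eventually_const_lt hM)] with i hi hi2 hi3 hi4
    by_contra! hle
    rw [lt_div_iff₀ (hpos _)] at hi2 hi4
    have := hmono (show m i + M ≤ n i by omega)
    have := hpos (m i)
    simp only at *
    nlinarith
  obtain ⟨k, -, hk⟩ := exists_eventually_eq_of_lt U hlt
  have hk0 : 0 < k := by
    obtain ⟨i, hi1, hi2⟩ := (hk.and hgt).exists
    omega
  refine ⟨k, hk0, ?_⟩
  have h1 := hlim.mul ((h.ratio_pow hs k).comp hm)
  rw [one_mul] at h1
  refine h1.congr' ?_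
  filter_upwards [hk, hgt] with i hi1 hi2
  simp only [Function.comp_apply]
  rw [show m i + k = n i by omega]
  have := hpos (m i)
  have := hpos (n i)
  field_simp

/-- The least `L ≥ L₀` with `t ≤ F L` works: the previous value is below `t`, so a single step
overshoots by at most the factor `K`. -/
theorem exists_subseq_scale {F : ℕ → ℕ} {K : ℕ} (hF : Tendsto F atTop atTop)
    (hK : ∀ᶠ L in atTop, F (L + 1) ≤ K * F L) :
    ∃ l : ℕ → ℕ, Tendsto l atTop atTop ∧ ∀ᶠ t in atTop, t ≤ F (l t) ∧ F (l t) ≤ K * t := by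
  classical
  obtain ⟨L₀, hL₀⟩ := eventually_atTop.1 hK
  have hex : ∀ t, ∃ L, L₀ ≤ L ∧ t ≤ F L := fun t =>
    ((eventually_ge_atTop L₀).and (hF.eventually_ge_atTop t)).exists
  refine ⟨fun t => Nat.find (hex t), ?_, ?_⟩
  · refine tendsto_atTop.2 fun b => ?_
    have : ∀ᶠ t in atTop, ∀ L ∈ Finset.range b, F L < t :=
      (eventually_all_finset _).2 fun L _ => eventually_gt_atTop _
    filter_upwards [this] with t ht
    by_contra! hlt
    have h1 := ht _ (Finset.mem_range.2 hlt)
    have h2 := (Nat.find_spec (hex t)).2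
    omega
  · filter_upwards [eventually_gt_atTop (F L₀)] with t ht
    have hspec := Nat.find_spec (hex t)
    refine ⟨hspec.2, ?_⟩
    set L := Nat.find (hex t) with hL
    have hne : L ≠ L₀ := by
      intro he
      rw [he] at hspec
      omega
    have hmin := Nat.find_min (hex t) (m := L - 1) (by omega)
    have h1 := hL₀ (L - 1) (by omega)
    rw [show L - 1 + 1 = L by omega] at h1
    refine h1.trans (Nat.mul_le_mul_left _ ?_)
    by_contra! hlt
    exact hmin ⟨by omega, hlt.le⟩

/-- Two scalings that describe the same sequence of positions have dependent ratios. -/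
theorem exists_pow_eq_pow_of_profiles {Q Q' : Type*} {s s' : ℕ → ℕ} {c c' : ℕ → ℝ} {θ θ' : ℝ}
    {Y : ℕ → Q} {Y' : ℕ → Q'} (h : HasScaling s c θ) (hs : SelfSimilar s Y)
    (h' : HasScaling s' c' θ') (hs' : SelfSimilar s' Y') {F : ℕ → ℕ} {K : ℕ}
    (hF : Tendsto F atTop atTop) (hK : ∀ᶠ L in atTop, F (L + 1) ≤ K * F L)
    {J J' : ℕ} {d d' : ℕ → ℝ} {κ κ' ν ν' : ℕ → ℕ} (hd : ∀ k, 0 < d k) (hd' : ∀ k, 0 < d' k)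
    (hκ : ∀ᶠ L in atTop, κ L < J) (hκ' : ∀ᶠ L in atTop, κ' L < J')
    (hν : Tendsto ν atTop atTop) (hν' : Tendsto ν' atTop atTop)
    (hlim : Tendsto (fun L => (F L : ℝ) / (s^[ν L] 1 : ℝ) - d (κ L)) atTop (𝓝 0))
    (hlim' : Tendsto (fun L => (F L : ℝ) / (s'^[ν' L] 1 : ℝ) - d' (κ' L)) atTop (𝓝 0)) :
    ∃ k l, 0 < k ∧ 0 < l ∧ θ ^ k = θ' ^ l := by
  wlog hK2 : 2 ≤ K generalizing K
  · refine this (K := K + 2) ?_ (by omega)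
    filter_upwards [hK] with L hL
    exact hL.trans (Nat.mul_le_mul_right _ (by omega))
  obtain ⟨l, hl, hlF⟩ := exists_subseq_scale hF hK
  have hU : (hyperfilter ℕ : Filter ℕ) ≤ atTop := Nat.hyperfilter_le_atTop
  have hKpos : ∀ j, 0 < K ^ j := fun j => pow_pos (by omega) j
  have hscale : ∀ j, Tendsto (fun i => K ^ (2 * j) * i) (hyperfilter ℕ : Filter ℕ) atTop :=
    fun j => (tendsto_id.const_mul_atTop' (hKpos _)).mono_left hU
  -- Here `F (G j i)` lies between `K ^ (2 * j) * i` and `K ^ (2 * j + 1) * i`. The exponent `2 * j`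
  -- leaves a factor `K ≥ 2` between the ranges of different `j`.
  let G : ℕ → ℕ → ℕ := fun j i => l (K ^ (2 * j) * i)
  have hG : ∀ j, Tendsto (G j) (hyperfilter ℕ : Filter ℕ) atTop := fun j => hl.comp (hscale j)
  choose k hkJ hk using fun j => exists_eventually_eq_of_lt _ ((hG j).eventually hκ)
  choose k' hkJ' hk' using fun j =>
    exists_eventually_eq_of_lt _ ((hG j).eventually hκ')
  -- Pigeonhole on both profile indices at once, so that the constants `d` and `d'` cancel in the
  -- same ratio `R`.
  obtain ⟨j₁, j₂, hne, heq⟩ := Finite.exists_ne_map_eq_of_infinite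
    fun j => ((⟨k j, hkJ j⟩, ⟨k' j, hkJ' j⟩) : Fin J × Fin J')
  wlog hlt : j₁ < j₂ generalizing j₁ j₂
  · exact this j₂ j₁ hne.symm heq.symm (by omega)
  simp only [Prod.mk.injEq, Fin.mk.injEq] at heq
  have hFpos : ∀ j, ∀ᶠ i in (hyperfilter ℕ : Filter ℕ), (0 : ℝ) < F (G j i) := fun j => by
    filter_upwards [(hF.comp (hG j)).eventually_ge_atTop 1] with i hi
    exact_mod_cast hi
  let R : ℕ → ℝ := fun i => (F (G j₂ i) : ℝ) / F (G j₁ i)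
  have hR : ∀ᶠ i in (hyperfilter ℕ : Filter ℕ), 2 ≤ R i ∧ R i ≤ (K : ℝ) ^ (2 * j₂ + 1) := by
    filter_upwards [(hscale j₁).eventually hlF, (hscale j₂).eventually hlF, hFpos j₁,
      hU (eventually_gt_atTop 0)] with i h1 h2 h3 h4
    simp only [R]
    rw [le_div_iff₀ h3, div_le_iff₀ h3]
    have e1 : K ^ (2 * j₂ + 1) = K * K ^ (2 * j₂) := pow_succ' _ _
    have e2 : 2 * (K * K ^ (2 * j₁)) ≤ K ^ (2 * j₂) := by
      calc 2 * (K * K ^ (2 * j₁)) ≤ K * (K * K ^ (2 * j₁)) := Nat.mul_le_mul_right _ hK2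
        _ = K ^ (2 * j₁ + 2) := by ring
        _ ≤ K ^ (2 * j₂) := Nat.pow_le_pow_right (by omega) (by omega)
    have h5 : 2 * F (G j₁ i) ≤ F (G j₂ i) :=
      calc 2 * F (G j₁ i) ≤ 2 * (K * (K ^ (2 * j₁) * i)) := Nat.mul_le_mul_left _ h1.2
        _ = 2 * (K * K ^ (2 * j₁)) * i := by ring
        _ ≤ K ^ (2 * j₂) * i := Nat.mul_le_mul_right _ e2
        _ ≤ F (G j₂ i) := h2.1
    have h6 : F (G j₂ i) ≤ K ^ (2 * j₂ + 1) * F (G j₁ i) :=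
      calc F (G j₂ i) ≤ K * (K ^ (2 * j₂) * i) := h2.2
        _ = K ^ (2 * j₂ + 1) * i := by ring
        _ ≤ K ^ (2 * j₂ + 1) * F (G j₁ i) :=
          Nat.mul_le_mul_left _ ((Nat.le_mul_of_pos_left i (hKpos _)).trans h1.1)
    exact ⟨by exact_mod_cast h5, by exact_mod_cast h6⟩
  have key : ∀ {s : ℕ → ℕ} {c : ℕ → ℝ} {θ : ℝ}, HasScaling s c θ →
      SelfSimilar s (id : ℕ → ℕ) → ∀ {d : ℕ → ℝ} {κ ν k : ℕ → ℕ}, (∀ k, 0 < d k) →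
      Tendsto ν atTop atTop →
      Tendsto (fun L => (F L : ℝ) / (s^[ν L] 1 : ℝ) - d (κ L)) atTop (𝓝 0) →
      (∀ j, ∀ᶠ i in (hyperfilter ℕ : Filter ℕ), κ (G j i) = k j) → k j₁ = k j₂ →
      ∃ n, 0 < n ∧ Tendsto R (hyperfilter ℕ : Filter ℕ) (𝓝 (θ ^ n)) := by
    intro s c θ h hs d κ ν k hd hν hlim hk hkk
    have hconv : ∀ j, Tendsto (fun i => (F (G j i) : ℝ) / (s^[ν (G j i)] 1 : ℝ))
        (hyperfilter ℕ : Filter ℕ) (𝓝 (d (k j))) := fun j => by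
      have h1 := (hlim.comp (hG j)).add_const (d (k j))
      rw [zero_add] at h1
      refine h1.congr' ?_
      filter_upwards [hk j] with i hi
      simp [hi]
    refine exists_tendsto_theta_pow h hs _ (hν.comp (hG j₁)) hR (n := fun i => ν (G j₂ i)) ?_
    have h1 := (hconv j₂).div (hconv j₁) (hd _).ne'
    rw [hkk, div_self (hd _).ne'] at h1
    refine h1.congr' ?_
    filter_upwards [hFpos j₁] with i hi
    have := HasScaling.iterate_one_pos hs (ν (G j₁ i))
    have := HasScaling.iterate_one_pos hs (ν (G j₂ i))
    simp only [R, Function.comp_apply, Pi.div_apply]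
    field_simp
  obtain ⟨n, hn, h1⟩ := key h hs.id hd hν hlim hk heq.1
  obtain ⟨n', hn', h2⟩ := key h' hs'.id hd' hν' hlim' hk' heq.2
  exact ⟨n, n', hn, hn', tendsto_nhds_unique h1 h2⟩

/-- Two multiplicatively independent scalings force bounded gaps. -/
theorem hasBoundedGaps_of_scalings {Q Q' : Type*} [Finite Q] [Finite Q'] {s s' : ℕ → ℕ}
    {c c' : ℕ → ℝ} {θ θ' : ℝ} {Y : ℕ → Q} {Y' : ℕ → Q'} {E : Set ℕ}
    (h : HasScaling s c θ) (hs : SelfSimilar s Y) (hdet : LetterDetermined Y E)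
    (h' : HasScaling s' c' θ') (hs' : SelfSimilar s' Y') (hdet' : LetterDetermined Y' E)
    (hind : ∀ k l : ℕ, 0 < k → 0 < l → θ ^ k ≠ θ' ^ l) (hE : E.Infinite) : HasBoundedGaps E := by
  by_contra hgap
  obtain ⟨P, hP, hid⟩ := exists_iterate_hitSet_idem hs hdet
  obtain ⟨P', hP', hid'⟩ := exists_iterate_hitSet_idem hs' hdet'
  obtain ⟨K, hK⟩ := firstGap_succ_le (h.pow hs hP) (hs.iterate P) hid hE hgap
  obtain ⟨J, d, κ, ν, hd, hκ, hν, hlim⟩ :=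
    firstGap_profile (h.pow hs hP) (hs.iterate P) hid hdet hE hgap
  obtain ⟨J', d', κ', ν', hd', hκ', hν', hlim'⟩ :=
    firstGap_profile (h'.pow hs' hP') (hs'.iterate P') hid' hdet' hE hgap
  obtain ⟨k, l, hk, hl, he⟩ := exists_pow_eq_pow_of_profiles (h.pow hs hP) (hs.iterate P)
    (h'.pow hs' hP') (hs'.iterate P') (firstGap_tendsto hgap hE) hK hd hd' hκ hκ' hν hν' hlim hlim'
  rw [← pow_mul, ← pow_mul] at he
  exact hind _ _ (Nat.mul_pos hP hk) (Nat.mul_pos hP' hl) he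

/-! ### Leading term of the orbit of a vector under a linear map -/

section Choose

theorem tendsto_choose_div_choose {k D : ℕ} (h : k < D) :
    Tendsto (fun n : ℕ => (n.choose k : ℝ) / (n.choose D : ℝ)) atTop (𝓝 0) := by
  have h1 : (fun n : ℕ => (n : ℝ) ^ k) =o[atTop] fun n : ℕ => (n : ℝ) ^ D :=
    (Asymptotics.isLittleO_pow_pow_atTop_of_lt h).comp_tendsto tendsto_natCast_atTop_atTop
  exact (((isTheta_choose k).trans_isLittleO h1).trans_isTheta
    (isTheta_choose D).symm).tendsto_div_nhds_zero

theorem tendsto_choose_add_div_choose (D m : ℕ) :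
    Tendsto (fun n : ℕ => ((n + m).choose D : ℝ) / (n.choose D : ℝ)) atTop (𝓝 1) := by
  induction m with
  | zero =>
    refine tendsto_const_nhds.congr' ?_
    filter_upwards [eventually_ge_atTop D] with n hn
    have : (n.choose D : ℝ) ≠ 0 := by exact_mod_cast (Nat.choose_pos hn).ne'
    simp [div_self this]
  | succ m ih =>
    have h1 : Tendsto (fun n : ℕ => ((n + 1).choose D : ℝ) / (n.choose D : ℝ)) atTop (𝓝 1) := by
      cases D with
      | zero => simp
      | succ D =>
        have h2 := (tendsto_choose_div_choose (Nat.lt_add_one D)).add_const 1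
        rw [zero_add] at h2
        refine h2.congr' ?_
        filter_upwards [eventually_ge_atTop (D + 1)] with n hn
        have : (n.choose (D + 1) : ℝ) ≠ 0 := by exact_mod_cast (Nat.choose_pos hn).ne'
        rw [Nat.choose_succ_succ]
        push_cast
        field_simp
    have h2 := (h1.comp (tendsto_add_atTop_nat m)).mul ih
    rw [one_mul] at h2
    refine h2.congr' ?_
    filter_upwards [eventually_ge_atTop D] with n hn
    have : ((n + m).choose D : ℝ) ≠ 0 := by exact_mod_cast (Nat.choose_pos (by omega)).ne'
    simp only [Function.comp_apply, add_assoc]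
    field_simp

end Choose

section Endomorphism

variable {V : Type*} [NormedAddCommGroup V] [NormedSpace ℂ V]

/-- Binomial expansion of `((f - μ) + μ) ^ n` on a generalized eigenvector; the number of terms does
not depend on `n`. -/
theorem pow_apply_of_sub_pow_eq_zero (f : Module.End ℂ V) (μ : ℂ) {d : ℕ} {x : V}
    (hx : ((f - μ • 1) ^ d) x = 0) (n : ℕ) :
    (f ^ n) x = ∑ k ∈ Finset.range d, ((n.choose k : ℂ) * μ ^ (n - k)) • ((f - μ • 1) ^ k) x := by
  have hzero : ∀ k, d ≤ k → ((f - μ • 1) ^ k) x = 0 := fun k hk => by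
    rw [show k = (k - d) + d by omega, pow_add, Module.End.mul_apply, hx, map_zero]
  have hc : Commute (f - μ • 1) (μ • (1 : Module.End ℂ V)) :=
    (Commute.one_right _).smul_right μ
  have h1 : (f ^ n) x =
      ∑ k ∈ Finset.range (n + 1), ((n.choose k : ℂ) * μ ^ (n - k)) • ((f - μ • 1) ^ k) x := by
    conv_lhs => rw [show f = (f - μ • 1) + μ • 1 by abel, hc.add_pow, LinearMap.sum_apply]
    refine Finset.sum_congr rfl fun k _ => ?_
    rw [smul_pow, one_pow, mul_assoc, Module.End.mul_apply, smul_mul_assoc, one_mul,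
      LinearMap.smul_apply, Module.End.natCast_apply, map_smul, ← Nat.cast_smul_eq_nsmul ℂ,
      map_smul, smul_smul, mul_comm]
  rw [h1]
  have h2 : Finset.range (n + 1) ⊆ Finset.range (n + 1 + d) :=
    Finset.range_subset_range.2 (by omega)
  have h3 : Finset.range d ⊆ Finset.range (n + 1 + d) := Finset.range_subset_range.2 (by omega)
  rw [Finset.sum_subset h2, Finset.sum_subset h3]
  · intro k _ hk
    rw [hzero k (by simpa using hk), smul_zero]
  · intro k _ hk
    rw [Nat.choose_eq_zero_of_lt (by simpa using hk)]
    simp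

theorem tendsto_coeff_of_norm_lt {ρ : ℝ} {μ : ℂ} (h : ‖μ‖ < ρ) (k D : ℕ) :
    Tendsto (fun n : ℕ => ((n.choose D : ℂ) * (ρ : ℂ) ^ n)⁻¹ * ((n.choose k : ℂ) * μ ^ (n - k)))
      atTop (𝓝 0) := by
  have hρ : 0 < ρ := (norm_nonneg _).trans_lt h
  by_cases hμ : μ = 0
  · refine tendsto_const_nhds.congr' ?_
    filter_upwards [eventually_gt_atTop k] with n hn
    rw [hμ, zero_pow (by omega)]
    simp
  · have hμ' : 0 < ‖μ‖ := norm_pos_iff.2 hμ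
    have h1 := (tendsto_pow_const_mul_const_pow_of_abs_lt_one k (r := ‖μ‖ / ρ) (by
      rw [abs_of_nonneg (by positivity)]; exact (div_lt_one hρ).2 h)).mul_const ((‖μ‖ ^ k)⁻¹)
    rw [zero_mul] at h1
    refine squeeze_zero_norm' ?_ h1
    filter_upwards [eventually_ge_atTop D, eventually_ge_atTop k] with n hn hk
    have hC : (1 : ℝ) ≤ n.choose D := by exact_mod_cast Nat.choose_pos hn
    have hC' : (n.choose k : ℝ) ≤ (n : ℝ) ^ k := by exact_mod_cast Nat.choose_le_pow n k
    simp only [norm_mul, norm_inv, norm_pow, Complex.norm_natCast, Complex.norm_real,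
      Real.norm_of_nonneg hρ.le]
    rw [pow_sub₀ _ hμ'.ne' hk]
    calc ((n.choose D : ℝ) * ρ ^ n)⁻¹ * ((n.choose k : ℝ) * (‖μ‖ ^ n * (‖μ‖ ^ k)⁻¹))
        ≤ (1 * ρ ^ n)⁻¹ * ((n : ℝ) ^ k * (‖μ‖ ^ n * (‖μ‖ ^ k)⁻¹)) := by gcongr
      _ = _ := by rw [div_pow]; field_simp

theorem tendsto_coeff_of_lt {ρ : ℝ} (hρ : 0 < ρ) {μ : ℂ} (h : ‖μ‖ = ρ) {k D : ℕ} (hk : k < D) :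
    Tendsto (fun n : ℕ => ((n.choose D : ℂ) * (ρ : ℂ) ^ n)⁻¹ * ((n.choose k : ℂ) * μ ^ (n - k)))
      atTop (𝓝 0) := by
  have h1 := (tendsto_choose_div_choose hk).mul_const ((ρ ^ k)⁻¹)
  rw [zero_mul] at h1
  refine squeeze_zero_norm' ?_ h1
  filter_upwards [eventually_ge_atTop D] with n hn
  have hC : (n.choose D : ℝ) ≠ 0 := by exact_mod_cast (Nat.choose_pos hn).ne'
  simp only [norm_mul, norm_inv, norm_pow, Complex.norm_natCast, Complex.norm_real,
    Real.norm_of_nonneg hρ.le, h]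
  rw [pow_sub₀ _ hρ.ne' (by omega)]
  apply le_of_eq
  field_simp

/-- Leading term of the orbit of a vector under an endomorphism of a complex vector space. -/
theorem exists_leading_term [FiniteDimensional ℂ V] (f : Module.End ℂ V) (v : V)
    (hv : ∀ n, (f ^ n) v ≠ 0) :
    ∃ (ρ : ℝ) (D : ℕ) (S : Finset ℂ) (w : ℂ → V), 0 < ρ ∧ S.Nonempty ∧
      (∀ μ ∈ S, ‖μ‖ = ρ ∧ f (w μ) = μ • w μ ∧ w μ ≠ 0) ∧
      Tendsto (fun n : ℕ => ((n.choose D : ℂ) * (ρ : ℂ) ^ n)⁻¹ • (f ^ n) v -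
        ∑ μ ∈ S, (μ / ρ) ^ n • w μ) atTop (𝓝 0) := by
  classical
  obtain ⟨g, hg, hsum⟩ := (Submodule.mem_iSup_iff_exists_finsupp f.maxGenEigenspace v).1
    (by rw [Module.End.iSup_maxGenEigenspace_eq_top]; trivial)
  set d := Module.finrank ℂ V with hd
  have hgd : ∀ μ : ℂ, ((f - μ • 1 : Module.End ℂ V) ^ d) (g μ) = 0 := fun μ => by
    have := hg μ
    rw [Module.End.maxGenEigenspace_eq_genEigenspace_finrank,
      Module.End.mem_genEigenspace_nat] at this
    simpa using this
  have hfn : ∀ n, (f ^ n) v = ∑ μ ∈ g.support, ∑ k ∈ Finset.range d,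
      ((n.choose k : ℂ) * μ ^ (n - k)) • ((f - μ • 1) ^ k) (g μ) := fun n => by
    rw [← hsum, Finsupp.sum, map_sum]
    exact Finset.sum_congr rfl fun μ _ => pow_apply_of_sub_pow_eq_zero f μ (hgd μ) n
  have hne : g.support.Nonempty := by
    rw [Finset.nonempty_iff_ne_empty]
    intro he
    refine hv 0 ?_
    rw [hfn, he, Finset.sum_empty]
  obtain ⟨μ₀, hμ₀, hmax⟩ := g.support.exists_max_image (fun μ => ‖μ‖) hne
  set ρ := ‖μ₀‖ with hρdef
  have hρ : 0 < ρ := by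
    by_contra! hle
    refine hv d ?_
    rw [hfn]
    refine Finset.sum_eq_zero fun μ hμ => Finset.sum_eq_zero fun k hk => ?_
    have : μ = 0 := norm_le_zero_iff.1 ((hmax μ hμ).trans hle)
    rw [this, zero_pow (by simp at hk; omega)]
    simp
  have hρC : (ρ : ℂ) ≠ 0 := by exact_mod_cast hρ.ne'
  -- The exponents of the nonzero nilpotent terms at the top modulus `ρ`. Their maximum `D` gives
  -- the dominant growth `n.choose D * ρ ^ n`, and maximality makes the surviving vectors genuine
  -- eigenvectors.
  let T := (Finset.range d).filter fun k => ∃ μ ∈ g.support, ‖μ‖ = ρ ∧ ((f - μ • 1) ^ k) (g μ) ≠ 0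
  have hT : T.Nonempty := by
    refine ⟨0, Finset.mem_filter.2 ⟨?_, μ₀, hμ₀, rfl, by simpa using hμ₀⟩⟩
    rw [Finset.mem_range]
    by_contra! hle
    have := hgd μ₀
    rw [show d = 0 by omega] at this
    exact Finsupp.mem_support_iff.1 hμ₀ (by simpa using this)
  obtain ⟨D, hD, hDmax⟩ := T.exists_max_image id hT
  obtain ⟨hDd, μ₁, hμ₁, hμ₁ρ, hμ₁D⟩ := Finset.mem_filter.1 hD
  let S := g.support.filter fun μ => ‖μ‖ = ρ ∧ ((f - μ • 1) ^ D) (g μ) ≠ 0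
  let w : ℂ → V := fun μ => (μ ^ D)⁻¹ • ((f - μ • 1) ^ D) (g μ)
  have htop : ∀ μ ∈ g.support, ‖μ‖ = ρ → ∀ k, D < k → ((f - μ • 1) ^ k) (g μ) = 0 := by
    intro μ hμ hμρ k hk
    by_contra hne'
    by_cases hkd : k < d
    · have : k ≤ D := hDmax k (Finset.mem_filter.2 ⟨Finset.mem_range.2 hkd, μ, hμ, hμρ, hne'⟩)
      omega
    · refine hne' ?_
      rw [show k = (k - d) + d by omega, pow_add, Module.End.mul_apply, hgd, map_zero]
  have hS0 : ∀ μ ∈ S, μ ≠ 0 := fun μ hμ h0 => by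
    have := (Finset.mem_filter.1 hμ).2.1
    rw [h0, norm_zero] at this
    exact hρ.ne this
  refine ⟨ρ, D, S, w, hρ, ⟨μ₁, Finset.mem_filter.2 ⟨hμ₁, hμ₁ρ, hμ₁D⟩⟩, fun μ hμ => ?_, ?_⟩
  · obtain ⟨h1, h2, h3⟩ := Finset.mem_filter.1 hμ
    refine ⟨h2, ?_, smul_ne_zero (inv_ne_zero (pow_ne_zero _ (hS0 μ hμ))) h3⟩
    have h4 := htop μ h1 h2 (D + 1) (by omega)
    rw [pow_succ', Module.End.mul_apply, LinearMap.sub_apply, sub_eq_zero] at h4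
    simp only [w]
    rw [map_smul, h4]
    rw [LinearMap.smul_apply, Module.End.one_apply, smul_comm]
  · have hterm : ∀ μ ∈ g.support, ∀ k ∈ Finset.range d, Tendsto (fun n : ℕ =>
        (((n.choose D : ℂ) * (ρ : ℂ) ^ n)⁻¹ * ((n.choose k : ℂ) * μ ^ (n - k))) •
          ((f - μ • 1) ^ k) (g μ) - if k = D ∧ μ ∈ S then (μ / ρ) ^ n • w μ else 0)
        atTop (𝓝 0) := by
      intro μ hμ k hk
      have hsmul : Tendsto (fun n : ℕ => ((n.choose D : ℂ) * (ρ : ℂ) ^ n)⁻¹ *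
          ((n.choose k : ℂ) * μ ^ (n - k))) atTop (𝓝 0) → ¬ (k = D ∧ μ ∈ S) → Tendsto (fun n : ℕ =>
        (((n.choose D : ℂ) * (ρ : ℂ) ^ n)⁻¹ * ((n.choose k : ℂ) * μ ^ (n - k))) •
          ((f - μ • 1) ^ k) (g μ) - if k = D ∧ μ ∈ S then (μ / ρ) ^ n • w μ else 0)
        atTop (𝓝 0) := fun h hn => by
        simp only [hn, if_false, sub_zero]
        simpa using h.smul_const (((f - μ • 1) ^ k) (g μ))
      rcases (hmax μ hμ).lt_or_eq with hlt | heq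
      · refine hsmul (tendsto_coeff_of_norm_lt hlt k D) fun h => ?_
        exact hlt.ne (Finset.mem_filter.1 h.2).2.1
      · rcases lt_trichotomy k D with hkD | hkD | hkD
        · exact hsmul (tendsto_coeff_of_lt hρ heq hkD) fun h => hkD.ne h.1
        · by_cases hμS : μ ∈ S
          · refine tendsto_const_nhds.congr' ?_
            filter_upwards [eventually_ge_atTop D] with n hn
            have hC : (n.choose D : ℂ) ≠ 0 := by exact_mod_cast (Nat.choose_pos hn).ne'
            have hμ0 := hS0 μ hμS
            rw [if_pos ⟨hkD, hμS⟩, hkD]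
            simp only [w]
            rw [smul_smul, ← sub_smul, pow_sub₀ _ hμ0 hn, div_pow]
            symm
            convert zero_smul ℂ _ using 2
            field_simp
            ring
          · have hz : ((f - μ • 1) ^ k) (g μ) = 0 := by
              by_contra hne'
              exact hμS (Finset.mem_filter.2 ⟨hμ, heq, by rwa [← hkD]⟩)
            simp [hz, hμS]
        · simp [htop μ hμ heq k hkD, hkD.ne']
    have hsumt := tendsto_finsetSum g.support fun μ hμ =>
      tendsto_finsetSum (Finset.range d) fun k hk => hterm μ hμ k hk
    simp only [Finset.sum_const_zero] at hsumt
    refine hsumt.congr fun n => ?_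
    simp only [Finset.sum_sub_distrib]
    rw [hfn, Finset.smul_sum]
    congr 1
    · refine Finset.sum_congr rfl fun μ _ => ?_
      rw [Finset.smul_sum]
      exact Finset.sum_congr rfl fun k _ => (smul_smul _ _ _).symm
    · refine (Finset.sum_subset_zero_on_sdiff (Finset.filter_subset _ _) (fun μ hμ => ?_)
        fun μ hμ => ?_).symm
      · have hμS : μ ∉ S := (Finset.mem_sdiff.1 hμ).2
        simp only [hμS, and_false, if_false, Finset.sum_const_zero]
      · have hμS : μ ∈ S := hμ
        simp only [hμS, and_true, Finset.sum_ite_eq', hDd, if_true]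

end Endomorphism

/-! ### Positivity forces root-of-unity frequencies -/

theorem tendsto_cesaro_pow {z : ℂ} (hz : ‖z‖ = 1) :
    Tendsto (fun n : ℕ => (n : ℝ)⁻¹ • ∑ m ∈ Finset.range n, z ^ m) atTop
      (𝓝 (if z = 1 then 1 else 0)) := by
  by_cases h1 : z = 1
  · have : Tendsto (fun n : ℕ => z ^ n) atTop (𝓝 1) := by simp [h1]
    simpa [h1] using this.cesaro_smul
  · rw [if_neg h1]
    have h2 : 0 < ‖z - 1‖ := norm_pos_iff.2 (sub_ne_zero.2 h1)
    have h3 : Tendsto (fun n : ℕ => (n : ℝ)⁻¹ * (2 / ‖z - 1‖)) atTop (𝓝 0) := by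
      simpa using (tendsto_inv_atTop_nhds_zero_nat (𝕜 := ℝ)).mul_const (2 / ‖z - 1‖)
    refine squeeze_zero_norm (fun n => ?_) h3
    rw [norm_smul, geom_sum_eq h1, norm_div, norm_inv, Real.norm_natCast]
    gcongr
    refine (norm_sub_le _ _).trans ?_
    rw [norm_pow, hz]
    norm_num

/-- A Fourier coefficient: twisting by `(ρ / l) ^ m` and averaging kills every frequency except `l`.
-/
theorem tendsto_cesaro_coeff {ρ : ℝ} (hρ : 0 < ρ) {S : Finset ℂ} (hS : ∀ μ ∈ S, ‖μ‖ = ρ)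
    {w : ℂ → ℂ} {x : ℕ → ℂ}
    (hx : Tendsto (fun n => x n - ∑ μ ∈ S, (μ / ρ) ^ n * w μ) atTop (𝓝 0)) {l : ℂ} (hl : ‖l‖ = ρ) :
    Tendsto (fun n : ℕ => (n : ℝ)⁻¹ • ∑ m ∈ Finset.range n, (ρ / l) ^ m * x m) atTop
      (𝓝 (if l ∈ S then w l else 0)) := by
  classical
  have hρC : (ρ : ℂ) ≠ 0 := by exact_mod_cast hρ.ne'
  have hl0 : l ≠ 0 := by
    intro h
    rw [h, norm_zero] at hl
    exact hρ.ne hl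
  have h1 : Tendsto (fun n => (ρ / l) ^ n * (x n - ∑ μ ∈ S, (μ / ρ) ^ n * w μ)) atTop (𝓝 0) := by
    rw [tendsto_zero_iff_norm_tendsto_zero] at hx ⊢
    refine hx.congr fun n => ?_
    rw [norm_mul, norm_pow, norm_div, hl, Complex.norm_real, Real.norm_of_nonneg hρ.le,
      div_self hρ.ne', one_pow, one_mul]
  have h2 := tendsto_finsetSum S fun μ hμ => (tendsto_cesaro_pow (z := μ / l) (by
    rw [norm_div, hl, hS μ hμ, div_self hρ.ne'])).mul_const (w μ)
  have h3 := h1.cesaro_smul.add h2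
  have h4 : (0 : ℂ) + ∑ μ ∈ S, (if μ / l = 1 then 1 else 0) * w μ = if l ∈ S then w l else 0 := by
    simp only [div_eq_one_iff_eq hl0, ite_mul, one_mul, zero_mul, zero_add, Finset.sum_ite_eq']
  rw [h4] at h3
  refine h3.congr fun n => ?_
  simp only [smul_mul_assoc]
  rw [← Finset.smul_sum, ← smul_add]
  congr 1
  simp only [Finset.sum_mul]
  rw [Finset.sum_comm, ← Finset.sum_add_distrib]
  refine Finset.sum_congr rfl fun m _ => ?_
  rw [mul_sub, Finset.mul_sum, sub_add_eq_add_sub, add_sub_assoc]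
  convert add_zero _
  rw [sub_eq_zero]
  refine Finset.sum_congr rfl fun μ _ => ?_
  rw [← mul_assoc, ← mul_pow]
  congr 2
  field_simp

/-- For a nonnegative sequence, the coefficient at the positive real frequency dominates. -/
theorem norm_coeff_le {ρ : ℝ} (hρ : 0 < ρ) {S : Finset ℂ} (hS : ∀ μ ∈ S, ‖μ‖ = ρ)
    {w : ℂ → ℂ} {x : ℕ → ℝ} (hx0 : ∀ n, 0 ≤ x n)
    (hx : Tendsto (fun n => (x n : ℂ) - ∑ μ ∈ S, (μ / ρ) ^ n * w μ) atTop (𝓝 0)) :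
    ∃ q : ℝ, (q : ℂ) = (if (ρ : ℂ) ∈ S then w ρ else 0) ∧ ∀ μ ∈ S, ‖w μ‖ ≤ q := by
  have hρC : (ρ : ℂ) ≠ 0 := by exact_mod_cast hρ.ne'
  have h1 := tendsto_cesaro_coeff hρ hS hx (l := ρ) (by simp [hρ.le])
  simp only [div_self hρC, one_pow, one_mul] at h1
  set L := if (ρ : ℂ) ∈ S then w ρ else 0 with hL
  have h1' : Tendsto (fun n : ℕ => (((n : ℝ)⁻¹ * ∑ m ∈ Finset.range n, x m : ℝ) : ℂ)) atTop
      (𝓝 L) := h1.congr fun n => by simp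
  have hre := (Complex.continuous_re.tendsto L).comp h1'
  have him := (Complex.continuous_im.tendsto L).comp h1'
  have hre' : Tendsto (fun n : ℕ => (n : ℝ)⁻¹ * ∑ m ∈ Finset.range n, x m) atTop (𝓝 L.re) := hre
  have him' : L.im = 0 := by
    refine tendsto_nhds_unique him (tendsto_const_nhds.congr fun n => ?_)
    exact (Complex.ofReal_im _).symm
  refine ⟨L.re, Complex.ext (by simp) (by simp [him']), fun μ hμ => ?_⟩
  have h2 := tendsto_cesaro_coeff hρ hS hx (hS μ hμ)
  rw [if_pos hμ] at h2
  refine le_of_tendsto_of_tendsto' h2.norm hre' fun n => ?_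
  rw [norm_smul, norm_inv, Real.norm_natCast]
  gcongr
  refine (norm_sum_le _ _).trans (Finset.sum_le_sum fun m _ => ?_)
  rw [norm_mul, norm_pow, norm_div, hS μ hμ, Complex.norm_real, Complex.norm_real,
    Real.norm_of_nonneg hρ.le, div_self hρ.ne', one_pow, one_mul, Real.norm_of_nonneg (hx0 m)]

theorem eq_of_norm_le_of_re_le {z q : ℂ} (h1 : ‖z‖ ≤ ‖q‖)
    (h2 : ‖q‖ ^ 2 ≤ (z * (starRingEnd ℂ) q).re) : z = q := by
  have h3 : ‖z - q‖ ^ 2 = ‖z‖ ^ 2 + ‖q‖ ^ 2 - 2 * (z * (starRingEnd ℂ) q).re := by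
    simp only [← Complex.normSq_eq_norm_sq, Complex.normSq_sub]
  have h4 : ‖z‖ ^ 2 ≤ ‖q‖ ^ 2 := by gcongr
  have h5 : ‖z - q‖ ^ 2 ≤ 0 := by linarith
  have h6 : ‖z - q‖ = 0 := by nlinarith [norm_nonneg (z - q)]
  exact sub_eq_zero.1 (norm_eq_zero.1 h6)

/-- An eigenvalue of a nonnegative matrix whose eigenvector is dominated by a nonnegative
eigenvector with eigenvalue of the same modulus differs from it by a root of unity. -/
theorem exists_pow_eq_one_of_dominated {A : Type*} [Fintype A] {M : Matrix A A ℕ} {ρ : ℝ}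
    (hρ : 0 < ρ) {l : ℂ} (hl : ‖l‖ = ρ) {q : A → ℝ} {w : A → ℂ} (hw : w ≠ 0)
    (hwq : ∀ a, ‖w a‖ ≤ q a) (hq : ∀ a, ∑ b, (M b a : ℝ) * q b = ρ * q a)
    (hlw : ∀ a, ∑ b, (M b a : ℂ) * w b = l * w a) : ∃ k, 0 < k ∧ (l / ρ) ^ k = 1 := by
  classical
  have hρC : (ρ : ℂ) ≠ 0 := by exact_mod_cast hρ.ne'
  have hq0 : ∀ a, 0 ≤ q a := fun a => (norm_nonneg _).trans (hwq a)
  obtain ⟨a₁, ha₁⟩ := Function.ne_iff.1 hw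
  -- Where `q a = 0` the quotient is 0 by convention, which is consistent because `w a` vanishes
  -- there.
  let z : A → ℂ := fun a => w a / q a
  have hwz : ∀ a, w a = q a * z a := fun a => by
    by_cases h : q a = 0
    · have : w a = 0 := norm_le_zero_iff.1 (h ▸ hwq a)
      simp [this, h]
    · have : (q a : ℂ) ≠ 0 := by exact_mod_cast h
      simp only [z]
      field_simp
  obtain ⟨a₀, -, hmax⟩ := Finset.univ.exists_max_image (fun a => ‖z a‖) ⟨a₁, Finset.mem_univ _⟩
  set r := ‖z a₀‖ with hr
  have hr0 : 0 < r := by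
    refine lt_of_lt_of_le (norm_pos_iff.2 fun h => ha₁ ?_) (hmax a₁ (Finset.mem_univ _))
    rw [hwz, h, mul_zero, Pi.zero_apply]
  have hqpos : ∀ a, ‖z a‖ = r → 0 < q a := fun a ha => by
    refine (hq0 a).lt_of_ne fun h => ?_
    simp only [z, ← h] at ha
    simp at ha
    exact hr0.ne ha
  have hζ : ‖l / ρ‖ = 1 := by
    rw [norm_div, hl, Complex.norm_real, Real.norm_of_nonneg hρ.le, div_self hρ.ne']
  -- At a point of maximal modulus, `l / ρ * z a` is a weighted average of the `z b` with weights
  -- proportional to `M b a * q b`. All `z b` lie in the disc of radius `r`, so every one with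
  -- positive weight equals the average.
  have hstep : ∀ a, ‖z a‖ = r → ∃ b, ‖z b‖ = r ∧ z b = l / ρ * z a := by
    intro a ha
    set t := l / ρ * z a with ht
    have htr : ‖t‖ = r := by rw [ht, norm_mul, hζ, one_mul, ha]
    have hsum : ∑ b, ((M b a : ℝ) * q b : ℝ) * (r ^ 2 - (z b * (starRingEnd ℂ) t).re) = 0 := by
      have h1 : ∑ b, ((M b a : ℂ) * q b) * (z b * (starRingEnd ℂ) t) =
          ((ρ * q a * r ^ 2 : ℝ) : ℂ) := by
        have h2 : ∑ b, ((M b a : ℂ) * q b) * (z b * (starRingEnd ℂ) t) =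
            (∑ b, (M b a : ℂ) * w b) * (starRingEnd ℂ) t := by
          rw [Finset.sum_mul]
          refine Finset.sum_congr rfl fun b _ => ?_
          rw [hwz b]
          ring
        rw [h2, hlw, hwz a, show l * (q a * z a) * (starRingEnd ℂ) t =
          ρ * q a * (t * (starRingEnd ℂ) t) by rw [ht]; field_simp, Complex.mul_conj,
          Complex.normSq_eq_norm_sq, htr]
        push_cast
        ring
      have h3 := congrArg Complex.re h1
      rw [Complex.re_sum, Complex.ofReal_re] at h3
      simp only [mul_sub, Finset.sum_sub_distrib, ← Finset.sum_mul, hq]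
      rw [sub_eq_zero, ← h3]
      refine Finset.sum_congr rfl fun b _ => ?_
      rw [show (M b a : ℂ) * q b = ((M b a * q b : ℝ) : ℂ) by push_cast; ring,
        Complex.re_ofReal_mul]
    have hle : ∀ b, (z b * (starRingEnd ℂ) t).re ≤ r ^ 2 := fun b => by
      refine (Complex.re_le_norm _).trans ?_
      rw [norm_mul, RCLike.norm_conj, htr, sq]
      exact mul_le_mul_of_nonneg_right (hmax b (Finset.mem_univ _)) hr0.le
    have hp : ∀ b, 0 ≤ (M b a : ℝ) * q b := fun b => mul_nonneg (Nat.cast_nonneg _) (hq0 b)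
    obtain ⟨b, hb⟩ : ∃ b, 0 < (M b a : ℝ) * q b := by
      by_contra! hcon
      have h0 : ρ * q a ≤ 0 := by
        rw [← hq]
        exact Finset.sum_nonpos fun b _ => hcon b
      have := mul_pos hρ (hqpos a ha)
      linarith
    have h4 := (Finset.sum_eq_zero_iff_of_nonneg fun b _ =>
      mul_nonneg (hp b) (sub_nonneg.2 (hle b))).1 hsum b (Finset.mem_univ _)
    have h5 : r ^ 2 = (z b * (starRingEnd ℂ) t).re := by
      rcases mul_eq_zero.1 h4 with h | h
      · exact absurd h hb.ne'
      · linarith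
    have h6 : z b = t := eq_of_norm_le_of_re_le (by rw [htr]; exact hmax b (Finset.mem_univ _))
      (by rw [htr, h5])
    exact ⟨b, by rw [h6, htr], h6⟩
  have horbit : ∀ n : ℕ, ∃ b, ‖z b‖ = r ∧ z b = (l / ρ) ^ n * z a₀ := by
    intro n
    induction n with
    | zero => exact ⟨a₀, rfl, by simp⟩
    | succ n ih =>
      obtain ⟨b, hb, hb'⟩ := ih
      obtain ⟨b', h1, h2⟩ := hstep b hb
      exact ⟨b', h1, by rw [h2, hb', pow_succ']; ring⟩
  choose o ho using horbit
  -- The orbit of multiplications by `l / ρ` visits finitely many letters; a repeated letter makes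
  -- `l / ρ` a root of unity.
  obtain ⟨i, j, hij, he⟩ := Finite.exists_ne_map_eq_of_infinite o
  wlog hlt : i < j generalizing i j
  · exact this j i hij.symm he.symm (by omega)
  have hz0 : z a₀ ≠ 0 := norm_pos_iff.1 hr0
  have hζ0 : l / ρ ≠ 0 := norm_pos_iff.1 (by rw [hζ]; norm_num)
  refine ⟨j - i, by omega, ?_⟩
  have h1 : (l / ρ) ^ i = (l / ρ) ^ j :=
    mul_right_cancel₀ hz0 (by rw [← (ho i).2, ← (ho j).2, he])
  rw [pow_sub₀ _ hζ0 hlt.le, ← h1, mul_inv_cancel₀ (pow_ne_zero _ hζ0)]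

/-! ### Growth of the column sums of matrix powers -/

section Matrix

variable {A : Type*} [Fintype A] [DecidableEq A]

theorem hasEigenvalue_transpose {M : Matrix A A ℕ} {z : ℂ}
    (h : Module.End.HasEigenvalue (Matrix.toLin' (M.transpose.map (Nat.cast : ℕ → ℂ))) z) :
    Module.End.HasEigenvalue (Matrix.toLin' (M.map (Nat.cast : ℕ → ℂ))) z := by
  rw [Module.End.hasEigenvalue_iff_isRoot_charpoly, Matrix.charpoly_toLin'] at h ⊢
  rwa [← Matrix.charpoly_transpose, ← Matrix.transpose_map]

/-- A common period for finitely many roots of unity. -/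
theorem exists_common_pow_eq_one {S : Finset ℂ} (h : ∀ z ∈ S, ∃ k, 0 < k ∧ z ^ k = 1) :
    ∃ p, 0 < p ∧ ∀ z ∈ S, z ^ p = 1 := by
  choose! k hk0 hk using h
  refine ⟨∏ z ∈ S, k z, Finset.prod_pos hk0, fun z hz => ?_⟩
  obtain ⟨m, hm⟩ := Finset.dvd_prod_of_mem k hz
  rw [hm, pow_mul, hk z hz, one_pow]

variable {M : Matrix A A ℕ} {U : ℕ → A → ℕ}

/-- The growth of the column sums of the powers of `M` along a suitable arithmetic progression. -/
theorem exists_tendsto_growth (h0 : ∀ a, U 0 a = 1) (hrec : ∀ n a, U (n + 1) a = ∑ b, M b a * U n b)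
    (hpos : ∀ n a, 0 < U n a) [Nonempty A] :
    ∃ (ρ : ℝ) (D p : ℕ) (W : A → ℝ), 0 < ρ ∧ 0 < p ∧ W ≠ 0 ∧
      (∃ z : ℂ, ‖z‖ = ρ ∧ Module.End.HasEigenvalue (Matrix.toLin' (M.map (Nat.cast : ℕ → ℂ))) z) ∧
      (∃ C : ℝ, ∀ᶠ n in atTop, ∀ a, (U n a : ℝ) ≤ C * ((n.choose D : ℝ) * ρ ^ n)) ∧
      ∀ a, Tendsto (fun n => (U (p * n) a : ℝ) / (((p * n).choose D : ℝ) * ρ ^ (p * n))) atTop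
        (𝓝 (W a)) := by
  classical
  set f := Matrix.toLin' (M.transpose.map (Nat.cast : ℕ → ℂ)) with hf
  have hfa : ∀ v a, f v a = ∑ b, (M b a : ℂ) * v b := fun v a => by
    simp [hf, Matrix.toLin'_apply, Matrix.mulVec, dotProduct]
  have hU : ∀ n a, (f ^ n) (fun _ => (1 : ℂ)) a = U n a := by
    intro n
    induction n with
    | zero => intro a; simp [h0]
    | succ n ih =>
      intro a
      rw [pow_succ', Module.End.mul_apply, hfa, hrec]
      push_cast
      exact Finset.sum_congr rfl fun b _ => by rw [ih]
  obtain ⟨ρ, D, S, w, hρ, hS, hw, hlim⟩ := exists_leading_term f (fun _ => (1 : ℂ)) fun n h => by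
    obtain ⟨a⟩ := ‹Nonempty A›
    have h1 := congrFun h a
    rw [hU, Pi.zero_apply] at h1
    exact (hpos n a).ne' (by exact_mod_cast h1)
  have hρC : (ρ : ℂ) ≠ 0 := by exact_mod_cast hρ.ne'
  let X : A → ℕ → ℝ := fun a n => (U n a : ℝ) / ((n.choose D : ℝ) * ρ ^ n)
  have hX : ∀ a, Tendsto (fun n => (X a n : ℂ) - ∑ μ ∈ S, (μ / ρ) ^ n * w μ a) atTop (𝓝 0) := by
    intro a
    have h1 := (tendsto_pi_nhds.1 hlim) a
    refine h1.congr fun n => ?_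
    simp only [Pi.sub_apply, Pi.smul_apply, smul_eq_mul, Finset.sum_apply, hU, X]
    push_cast
    ring
  have hSρ : ∀ μ ∈ S, ‖μ‖ = ρ := fun μ hμ => (hw μ hμ).1
  choose q hq hqw using fun a => norm_coeff_le hρ hSρ (w := fun μ => w μ a)
    (fun n => show 0 ≤ X a n by positivity) (hX a)
  have hqeig : ∀ a, ∑ b, (M b a : ℝ) * q b = ρ * q a := by
    intro a
    have h1 : ∑ b, (M b a : ℂ) * (q b : ℂ) = ρ * (q a : ℂ) := by
      simp only [hq]
      by_cases hmem : (ρ : ℂ) ∈ S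
      · simp only [hmem, if_true]
        rw [← hfa, (hw _ hmem).2.1]
        rfl
      · simp [hmem]
    exact_mod_cast h1
  have hroot : ∀ z ∈ S.image (· / (ρ : ℂ)), ∃ k, 0 < k ∧ z ^ k = 1 := by
    intro z hz
    obtain ⟨μ, hμ, rfl⟩ := Finset.mem_image.1 hz
    refine exists_pow_eq_one_of_dominated hρ (hSρ μ hμ) (hw μ hμ).2.2 (fun a => hqw a μ hμ) hqeig
      fun a => ?_
    rw [← hfa, (hw μ hμ).2.1]
    rfl
  obtain ⟨p, hp, hpS⟩ := exists_common_pow_eq_one hroot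
  have hpS' : ∀ μ ∈ S, (μ / ρ) ^ p = 1 := fun μ hμ => hpS _ (Finset.mem_image_of_mem _ hμ)
  have htp : Tendsto (fun n => p * n) atTop atTop := tendsto_id.const_mul_atTop' hp
  let W : A → ℂ := fun a => ∑ μ ∈ S, w μ a
  have hXW : ∀ a, Tendsto (fun n => (X a (p * n) : ℂ)) atTop (𝓝 (W a)) := by
    intro a
    have h1 := ((hX a).comp htp).add_const (W a)
    rw [zero_add] at h1
    refine h1.congr fun n => ?_
    have : ∑ μ ∈ S, (μ / ρ) ^ (p * n) * w μ a = W a :=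
      Finset.sum_congr rfl fun μ hμ => by rw [pow_mul, hpS' μ hμ, one_pow, one_mul]
    simp only [Function.comp_apply, this, sub_add_cancel]
  -- Eigenvectors for distinct eigenvalues cannot sum to zero: applying `f` repeatedly gives the
  -- relation with weights `μ ^ n`, and Cesàro averaging then isolates each `w μ`.
  have hW0 : W ≠ 0 := by
    intro hW
    have hW' : ∑ μ ∈ S, w μ = 0 := by
      funext a
      rw [Finset.sum_apply]
      exact congrFun hW a
    have hfn : ∀ n : ℕ, ∑ μ ∈ S, μ ^ n • w μ = 0 := by
      intro n
      induction n with
      | zero => simpa using hW'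
      | succ n ih =>
        have h1 := congrArg f ih
        rw [map_sum, map_zero] at h1
        rw [← h1]
        refine Finset.sum_congr rfl fun μ hμ => ?_
        rw [map_smul, (hw μ hμ).2.1, smul_smul, pow_succ]
    obtain ⟨μ, hμ⟩ := hS
    refine (hw μ hμ).2.2 ?_
    funext a
    have h1 := tendsto_cesaro_coeff hρ hSρ (w := fun μ => w μ a) (x := fun _ => 0) (by
      refine tendsto_const_nhds.congr fun n => ?_
      have h2 := congrFun (hfn n) a
      rw [Finset.sum_apply] at h2
      simp only [div_pow, div_mul_eq_mul_div, ← Finset.sum_div]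
      simp only [Pi.smul_apply, smul_eq_mul, Pi.zero_apply] at h2
      rw [h2]
      simp) (hSρ μ hμ)
    rw [if_pos hμ] at h1
    refine tendsto_nhds_unique h1 ?_
    simp
  have hXre : ∀ a, Tendsto (fun n => X a (p * n)) atTop (𝓝 (W a).re) := fun a =>
    (Complex.continuous_re.tendsto (W a)).comp (hXW a)
  have hWim : ∀ a, (W a).im = 0 := fun a =>
    tendsto_nhds_unique ((Complex.continuous_im.tendsto (W a)).comp (hXW a))
      (tendsto_const_nhds.congr fun n => (Complex.ofReal_im _).symm)
  refine ⟨ρ, D, p, fun a => (W a).re, hρ, hp, fun h => hW0 ?_, ?_, ?_, hXre⟩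
  · funext a
    exact Complex.ext (congrFun h a) (hWim a)
  · obtain ⟨μ, hμ⟩ := hS
    refine ⟨μ, hSρ μ hμ, hasEigenvalue_transpose ?_⟩
    exact Module.End.hasEigenvalue_of_hasEigenvector
      ⟨Module.End.mem_eigenspace_iff.2 (hw μ hμ).2.1, (hw μ hμ).2.2⟩
  · let C : A → ℝ := fun a => 1 + ∑ μ ∈ S, ‖w μ a‖
    have hC0 : ∀ a, 0 ≤ C a := fun a => by positivity
    refine ⟨∑ a, C a, ?_⟩
    have h1 : ∀ a, ∀ᶠ n in atTop, X a n ≤ C a := fun a => by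
      have h2 := (hX a).norm
      rw [norm_zero] at h2
      filter_upwards [h2.eventually_lt_const one_pos] with n hn
      have h3 : ‖∑ μ ∈ S, (μ / ρ) ^ n * w μ a‖ ≤ ∑ μ ∈ S, ‖w μ a‖ := by
        refine (norm_sum_le _ _).trans (Finset.sum_le_sum fun μ hμ => ?_)
        rw [norm_mul, norm_pow, norm_div, hSρ μ hμ, Complex.norm_real,
          Real.norm_of_nonneg hρ.le, div_self hρ.ne', one_pow, one_mul]
      have h4 := norm_sub_norm_le (X a n : ℂ) (∑ μ ∈ S, (μ / ρ) ^ n * w μ a)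
      rw [Complex.norm_real] at h4
      have h5 := Real.le_norm_self (X a n)
      simp only [C]
      linarith
    filter_upwards [eventually_all.2 h1, eventually_ge_atTop D] with n hn hnD a
    have hC : (0 : ℝ) < n.choose D := by exact_mod_cast Nat.choose_pos hnD
    have h2 := (div_le_iff₀ (by positivity)).1 (hn a)
    refine h2.trans (mul_le_mul_of_nonneg_right ?_ (by positivity))
    exact Finset.single_le_sum (fun a _ => hC0 a) (Finset.mem_univ a)

/-- An upper bound for the growth of the column sums bounds all eigenvalues. -/
theorem norm_eigenvalue_le_of_growth (h0 : ∀ a, U 0 a = 1)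
    (hrec : ∀ n a, U (n + 1) a = ∑ b, M b a * U n b) {ρ C : ℝ} {D : ℕ} (hρ : 0 < ρ)
    (hC : ∀ᶠ n in atTop, ∀ a, (U n a : ℝ) ≤ C * ((n.choose D : ℝ) * ρ ^ n)) {z : ℂ}
    (hz : Module.End.HasEigenvalue (Matrix.toLin' (M.map (Nat.cast : ℕ → ℂ))) z) : ‖z‖ ≤ ρ := by
  obtain ⟨x, hx⟩ := hz.exists_hasEigenvector
  have hxa : ∀ a, ∑ b, (M a b : ℂ) * x b = z * x a := fun a => by
    have h1 := congrFun hx.apply_eq_smul a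
    simpa [Matrix.toLin'_apply, Matrix.mulVec, dotProduct] using h1
  -- Pairing the column sums with the moduli of an eigenvector gives a quantity that grows at least
  -- like `‖z‖ ^ n`.
  let y : ℕ → ℝ := fun n => ∑ a, (U n a : ℝ) * ‖x a‖
  have hstep : ∀ n, ‖z‖ * y n ≤ y (n + 1) := by
    intro n
    have h1 : y (n + 1) = ∑ b, (U n b : ℝ) * ∑ a, (M b a : ℝ) * ‖x a‖ := by
      simp only [y, hrec, Finset.mul_sum]
      push_cast
      simp only [Finset.sum_mul]
      rw [Finset.sum_comm]
      exact Finset.sum_congr rfl fun b _ => Finset.sum_congr rfl fun a _ => by ring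
    rw [h1, Finset.mul_sum]
    refine Finset.sum_le_sum fun b _ => ?_
    have h2 : ‖z‖ * ‖x b‖ ≤ ∑ a, (M b a : ℝ) * ‖x a‖ := by
      rw [← norm_mul, ← hxa]
      refine (norm_sum_le _ _).trans (le_of_eq (Finset.sum_congr rfl fun a _ => ?_))
      rw [norm_mul, Complex.norm_natCast]
    calc ‖z‖ * ((U n b : ℝ) * ‖x b‖) = (U n b : ℝ) * (‖z‖ * ‖x b‖) := by ring
      _ ≤ _ := by gcongr
  have hpow : ∀ n, ‖z‖ ^ n * y 0 ≤ y n := by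
    intro n
    induction n with
    | zero => simp
    | succ n ih =>
      refine le_trans ?_ (hstep n)
      rw [pow_succ', mul_assoc]
      gcongr
  have hy0 : 0 < y 0 := by
    obtain ⟨a, ha⟩ := Function.ne_iff.1 hx.2
    refine Finset.sum_pos' (fun a _ => by positivity) ⟨a, Finset.mem_univ _, ?_⟩
    rw [h0, Nat.cast_one, one_mul]
    exact norm_pos_iff.2 ha
  by_contra! hlt
  have hz0 : 0 < ‖z‖ := hρ.trans hlt
  have hlim := (tendsto_pow_const_mul_const_pow_of_abs_lt_one D (r := ρ / ‖z‖) (by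
    rw [abs_of_nonneg (by positivity)]; exact (div_lt_one hz0).2 hlt)).const_mul
      (|C| * ∑ a, ‖x a‖)
  rw [mul_zero] at hlim
  obtain ⟨n, hn1, hn2⟩ := ((hlim.eventually_lt_const hy0).and hC).exists
  have h1 : y n ≤ |C| * ((n : ℝ) ^ D * ρ ^ n) * ∑ a, ‖x a‖ := by
    rw [Finset.mul_sum]
    refine Finset.sum_le_sum fun a _ => ?_
    gcongr
    refine (hn2 a).trans ?_
    have : (n.choose D : ℝ) ≤ (n : ℝ) ^ D := by exact_mod_cast Nat.choose_le_pow n D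
    exact mul_le_mul (le_abs_self C) (by gcongr) (by positivity) (abs_nonneg C)
  have h2 := (hpow n).trans h1
  rw [div_pow] at hn1
  have h3 : |C| * (∑ a, ‖x a‖) * ((n : ℝ) ^ D * (ρ ^ n / ‖z‖ ^ n)) * ‖z‖ ^ n =
      |C| * ((n : ℝ) ^ D * ρ ^ n) * ∑ a, ‖x a‖ := by
    field_simp
  have h4 := mul_lt_mul_of_pos_right hn1 (pow_pos hz0 n)
  rw [h3] at h4
  linarith

/-- The growth rate `ρ` is the modulus of an eigenvalue and bounds all of them, so it equals `α`.
The domination hypothesis on `a₀` makes its limit `W a₀` positive, so one can divide by `U (p * n)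
a₀`; the normalizing factors, binomials included, cancel in the limit. -/
theorem exists_growth_ratio (h0 : ∀ a, U 0 a = 1)
    (hrec : ∀ n a, U (n + 1) a = ∑ b, M b a * U n b) (hpos : ∀ n a, 0 < U n a) {α : ℝ}
    (hα : IsDominantEigenvalue M α) (a₀ : A)
    (ha₀ : ∀ a, ∃ N₀, ∀ N ≥ N₀, ∀ n, U n a ≤ U (n + N) a₀) :
    ∃ p, 0 < p ∧
      (∀ a, ∃ c : ℝ, Tendsto (fun n => (U (p * n) a : ℝ) / (U (p * n) a₀ : ℝ)) atTop (𝓝 c)) ∧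
      Tendsto (fun n => (U (p * (n + 1)) a₀ : ℝ) / (U (p * n) a₀ : ℝ)) atTop (𝓝 (α ^ p)) := by
  have : Nonempty A := ⟨a₀⟩
  obtain ⟨ρ, D, p, W, hρ, hp, hW, ⟨z, hz, hzM⟩, ⟨C, hC⟩, hlim⟩ :=
    exists_tendsto_growth h0 hrec hpos
  have hαρ : α = ρ := by
    refine le_antisymm ?_ (hz ▸ hα.2 z hzM)
    refine le_trans (Real.le_norm_self α) ?_
    rw [← Complex.norm_real]
    exact norm_eigenvalue_le_of_growth h0 hrec hρ hC hα.1
  have hWnn : ∀ a, 0 ≤ W a := fun a => ge_of_tendsto' (hlim a) fun n => by positivity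
  have htp : Tendsto (fun n => p * n) atTop atTop := tendsto_id.const_mul_atTop' hp
  let nrm : ℕ → ℝ := fun n => ((p * n).choose D : ℝ) * ρ ^ (p * n)
  have hnrm : ∀ᶠ n in atTop, 0 < nrm n := by
    filter_upwards [htp.eventually_ge_atTop D] with n hn
    have : (0 : ℝ) < (p * n).choose D := by exact_mod_cast Nat.choose_pos hn
    positivity
  have hshift : ∀ m a, Tendsto (fun n => (U (p * (n + m)) a : ℝ) / nrm n) atTop
      (𝓝 (W a * ρ ^ (p * m))) := by
    intro m a
    have h1 := ((hlim a).comp (tendsto_add_atTop_nat m)).mul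
      (((tendsto_choose_add_div_choose D (p * m)).comp htp).mul_const (ρ ^ (p * m)))
    rw [one_mul] at h1
    refine h1.congr' ?_
    filter_upwards [hnrm, (tendsto_add_atTop_nat m).eventually hnrm] with n hn hnm
    have h2 : ((p * n).choose D : ℝ) ≠ 0 := (pos_of_mul_pos_left hn (by positivity)).ne'
    have h3 : ((p * (n + m)).choose D : ℝ) ≠ 0 := (pos_of_mul_pos_left hnm (by positivity)).ne'
    simp only [Function.comp_apply, nrm]
    rw [← mul_add, show ρ ^ (p * (n + m)) = ρ ^ (p * n) * ρ ^ (p * m) by rw [mul_add, pow_add]]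
    field_simp
  have hWa₀ : 0 < W a₀ := by
    obtain ⟨a, ha⟩ := Function.ne_iff.1 hW
    have ha' : 0 < W a := (hWnn a).lt_of_ne (Ne.symm ha)
    obtain ⟨N₀, hN₀⟩ := ha₀ a
    have h1 : W a ≤ W a₀ * ρ ^ (p * N₀) := by
      refine le_of_tendsto_of_tendsto (hlim a) (hshift N₀ a₀) ?_
      filter_upwards [hnrm] with n hn
      have : (U (p * n) a : ℝ) ≤ U (p * (n + N₀)) a₀ := by
        rw [mul_add]
        exact_mod_cast hN₀ _ (by nlinarith) _
      exact div_le_div_of_nonneg_right this hn.le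
    exact pos_of_mul_pos_left (ha'.trans_le h1) (by positivity)
  have hratio : ∀ m a, Tendsto (fun n => (U (p * (n + m)) a : ℝ) / (U (p * n) a₀ : ℝ)) atTop
      (𝓝 (W a * ρ ^ (p * m) / W a₀)) := fun m a => by
    refine ((hshift m a).div (hlim a₀) hWa₀.ne').congr' ?_
    filter_upwards [hnrm] with n hn
    have h2 : (U (p * n) a₀ : ℝ) ≠ 0 := by exact_mod_cast (hpos _ _).ne'
    simp only [Pi.div_apply]
    change (U (p * (n + m)) a : ℝ) / nrm n / ((U (p * n) a₀ : ℝ) / nrm n) = _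
    field_simp
  refine ⟨p, hp, fun a => ⟨_, hratio 0 a⟩, ?_⟩
  have h1 := hratio 1 a₀
  rwa [mul_one, mul_div_cancel_left₀ _ hWa₀.ne', ← hαρ] at h1

end Matrix

/-! ### From substitutions to scaled self-similar cuttings -/

section Words

variable {A : Type*} {σ : A → List A} {y : ℕ → A}

/-- The length of `σⁿ(a)`. -/
def imageLength (σ : A → List A) (n : ℕ) (a : A) : ℕ := ((applyWord σ)^[n] [a]).length

/-- The position at which the image of the letter of index `k` starts. -/
def imageStart (σ : A → List A) (y : ℕ → A) (k : ℕ) : ℕ := (applyWord σ (factor y 0 k)).length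

theorem factor_succ {B : Type*} (x : ℕ → B) (i n : ℕ) :
    factor x i (n + 1) = factor x i n ++ [x (i + n)] := by
  simp [factor, List.range_succ]

theorem length_iterate_applyWord (σ : A → List A) (n : ℕ) (w : List A) :
    ((applyWord σ)^[n] w).length = (w.map (imageLength σ n)).sum := by
  have happ : ∀ v w, (applyWord σ)^[n] (v ++ w) = (applyWord σ)^[n] v ++ (applyWord σ)^[n] w := by
    induction n with
    | zero => simp
    | succ n ih => intro v w; simp only [Function.iterate_succ_apply, applyWord,
        List.flatMap_append] at *; exact ih _ _
  have hnil : (applyWord σ)^[n] [] = [] := by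
    have h := congrArg List.length (happ [] [])
    rw [List.append_nil, List.length_append] at h
    exact List.length_eq_zero_iff.1 (by omega)
  induction w with
  | nil => simp [hnil]
  | cons a w ih =>
    rw [← List.singleton_append, happ, List.length_append, ih]
    simp [imageLength]

theorem imageLength_zero (a : A) : imageLength σ 0 a = 1 := rfl

theorem imageLength_succ (n : ℕ) (a : A) :
    imageLength σ (n + 1) a = ((σ a).map (imageLength σ n)).sum := by
  rw [← length_iterate_applyWord, imageLength, Function.iterate_succ_apply]
  simp [applyWord]

theorem imageLength_succ_eq_sum [Fintype A] [DecidableEq A] (n : ℕ) (a : A) :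
    imageLength σ (n + 1) a = ∑ b, incidenceMatrix σ b a * imageLength σ n b := by
  rw [imageLength_succ, Finset.sum_list_map_count]
  refine Finset.sum_subset_zero_on_sdiff (Finset.subset_univ _) (fun b hb => ?_) fun b _ => ?_
  · have : b ∉ σ a := by simpa using hb
    simp [incidenceMatrix, List.count_eq_zero_of_not_mem this]
  · simp [incidenceMatrix]

theorem IsSubstitution.ne_nil (hσ : IsSubstitution σ) (a : A) : σ a ≠ [] := by
  intro h
  obtain ⟨n, hn, hn1⟩ := (((hσ a).eventually_ge_atTop 1).and (eventually_ge_atTop 1)).exists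
  obtain ⟨m, rfl⟩ : ∃ m, n = m + 1 := ⟨n - 1, by omega⟩
  have h1 := imageLength_succ (σ := σ) m a
  rw [h] at h1
  simp only [imageLength, List.map_nil, List.sum_nil] at h1
  omega

theorem IsSubstitution.imageLength_pos (hσ : IsSubstitution σ) (n : ℕ) (a : A) :
    0 < imageLength σ n a := by
  induction n generalizing a with
  | zero => exact Nat.one_pos
  | succ n ih =>
    rw [imageLength_succ]
    obtain ⟨b, l, hb⟩ := List.exists_cons_of_ne_nil (hσ.ne_nil a)
    rw [hb, List.map_cons, List.sum_cons]
    have := ih b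
    omega

theorem imageStart_succ (k : ℕ) :
    imageStart σ y (k + 1) = imageStart σ y k + (σ (y k)).length := by
  simp [imageStart, factor_succ, applyWord]

theorem getElem?_image (hy : IsSeqImage σ y y) {k r : ℕ} (hr : r < (σ (y k)).length) :
    (σ (y k))[r]? = some (y (imageStart σ y k + r)) := by
  have h1 := congrArg (fun l : List A => l[imageStart σ y k + r]?) (hy (k + 1))
  have h2 : (applyWord σ (factor y 0 (k + 1))).length = imageStart σ y k + (σ (y k)).length :=
    imageStart_succ k
  rw [h2] at h1
  have h3 : applyWord σ (factor y 0 (k + 1)) = applyWord σ (factor y 0 k) ++ σ (y k) := by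
    simp [factor_succ, applyWord]
  rw [h3, imageStart, List.getElem?_append_right (by omega), Nat.add_sub_cancel_left] at h1
  rw [h1]
  simp [factor, imageStart, hr]

theorem image_eq_factor (hy : IsSeqImage σ y y) (k : ℕ) :
    σ (y k) = factor y (imageStart σ y k) (σ (y k)).length := by
  refine List.ext_getElem? fun r => ?_
  by_cases hr : r < (σ (y k)).length
  · rw [getElem?_image hy hr]
    simp [factor, hr]
  · simp [factor, hr]

theorem selfSimilar_imageStart (hσ : IsSubstitution σ) (hy : IsSeqImage σ y y) :
    SelfSimilar (imageStart σ y) y := by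
  refine ⟨strictMono_nat_of_lt_succ fun k => ?_, rfl, fun j k hjk => ?_, fun j k r hjk hr => ?_⟩
  · have := List.length_pos_of_ne_nil (hσ.ne_nil (y k))
    rw [imageStart_succ]
    omega
  · rw [imageStart_succ, imageStart_succ, hjk]
    omega
  · rw [imageStart_succ] at hr
    have h1 := getElem?_image hy (k := j) (r := r) (by omega)
    have h2 := getElem?_image hy (k := k) (r := r) (by rw [← hjk]; omega)
    rw [hjk, h2] at h1
    exact (Option.some.inj h1).symm

theorem iterate_imageStart_succ (hy : IsSeqImage σ y y) (n k : ℕ) :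
    (imageStart σ y)^[n] (k + 1) = (imageStart σ y)^[n] k + imageLength σ n (y k) := by
  induction n generalizing k with
  | zero => rfl
  | succ n ih =>
    have h1 : ∀ i m, (imageStart σ y)^[n] (i + m) =
        (imageStart σ y)^[n] i + ((factor y i m).map (imageLength σ n)).sum := by
      intro i m
      induction m with
      | zero => simp [factor]
      | succ m ihm =>
        rw [← add_assoc, ih, ihm, factor_succ, List.map_append, List.sum_append]
        simp [add_assoc]
    rw [Function.iterate_succ_apply, Function.iterate_succ_apply, imageStart_succ, h1,
      ← image_eq_factor hy, imageLength_succ]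

/-- The positions of the images of letters in a proper fixed point have a scaling limit. -/
theorem exists_hasScaling [Fintype A] [DecidableEq A] (hσ : IsSubstitution σ) {α : ℝ}
    (hα : IsDominantEigenvalue (incidenceMatrix σ) α) (hy : IsProperFixedPoint σ y) :
    ∃ (s : ℕ → ℕ) (c : ℕ → ℝ) (p : ℕ), 0 < p ∧ SelfSimilar s y ∧ HasScaling s c (α ^ p) := by
  obtain ⟨hfix, hsurj⟩ := hy
  have hs := selfSimilar_imageStart hσ hfix
  have hsucc := iterate_imageStart_succ hfix
  have hone : ∀ n, (imageStart σ y)^[n] 1 = imageLength σ n (y 0) := fun n => by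
    have := hsucc n 0
    rwa [(hs.iterate n).zero, zero_add, zero_add] at this
  obtain ⟨p, hp, hc, hratio⟩ := exists_growth_ratio (U := imageLength σ) imageLength_zero
    imageLength_succ_eq_sum hσ.imageLength_pos hα (y 0) fun a => by
      -- Once the prefix `σ^N(y 0)` has length at least `k + 1` it contains the letter `y k`, so
      -- `σ^n(y k)` fits inside `σ^(n + N)(y 0)`.
      obtain ⟨k, rfl⟩ := hsurj a
      obtain ⟨N₀, hN₀⟩ := eventually_atTop.1 ((hσ (y 0)).eventually_ge_atTop (k + 1))
      refine ⟨N₀, fun N hN n => ?_⟩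
      have h1 : k + 1 ≤ (imageStart σ y)^[N] 1 := by
        rw [hone]
        exact hN₀ N hN
      have h2 := (hs.iterate n).mono.monotone h1
      rw [hsucc, ← Function.iterate_add_apply, hone] at h2
      omega
  choose c hc using hc
  have hmul : ∀ n, ((imageStart σ y)^[p])^[n] = (imageStart σ y)^[p * n] := fun n =>
    (Function.iterate_mul _ _ _).symm
  -- The substitution is replaced by its `p`-th power, since limits are available only along
  -- multiples of `p`. The limit of a boundary is the sum of the limiting lengths of the preceding
  -- blocks.
  refine ⟨(imageStart σ y)^[p], fun k => ∑ i ∈ Finset.range k, c (y i), p, hp, hs.iterate p,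
    fun k => ?_, ?_, fun B => ?_⟩
  · simp only [hmul]
    induction k with
    | zero => simp [(hs.iterate _).zero]
    | succ k ih =>
      rw [Finset.sum_range_succ]
      refine (ih.add (hc (y k))).congr fun n => ?_
      rw [hone, hsucc]
      push_cast
      rw [add_div]
  · simp only [hmul, hone]
    exact hratio
  · have h1 : ∀ᶠ n in atTop, ∀ a, B ≤ imageLength σ n a :=
      eventually_all.2 fun a => (hσ a).eventually_ge_atTop B
    obtain ⟨N, hN⟩ := eventually_atTop.1 h1
    refine ⟨N, fun n hn k => ?_⟩
    rw [hmul, hsucc]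
    have := hN (p * n) (by nlinarith) (y k)
    omega

theorem letterDetermined_occurrences {C : Type*} {φ : A → C} {x : ℕ → C}
    (hφ : ∀ n, φ (y n) = x n) (u : List C) :
    LetterDetermined (fun k (i : Fin (u.length + 1)) => y (k + i)) (occurrences x u) := by
  intro j k hjk hj
  have h1 : factor x k u.length = factor x j u.length := by
    refine List.map_congr_left fun i hi => ?_
    have h2 := congrFun hjk ⟨i, by rw [List.mem_range] at hi; omega⟩
    rw [← hφ, ← hφ]
    exact congrArg φ h2.symm
  exact h1.trans hj

end Words

end CobhamSubst

theorem mainTheorem4 {A B C : Type*} [Fintype A] [DecidableEq A] [Fintype B] [DecidableEq B]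
    [Finite C] (α β : ℝ)
    (hα : CobhamSubst.IsPerronNumber α) (hβ : CobhamSubst.IsPerronNumber β)
    (hαβ : CobhamSubst.MultiplicativelyIndependent α β)
    (σ : A → List A) (τ : B → List B)
    (hσ : CobhamSubst.IsSubstitution σ) (hτ : CobhamSubst.IsSubstitution τ)
    (hσα : CobhamSubst.IsDominantEigenvalue (CobhamSubst.incidenceMatrix σ) α)
    (hτβ : CobhamSubst.IsDominantEigenvalue (CobhamSubst.incidenceMatrix τ) β)
    (y : ℕ → A) (z : ℕ → B)
    (hy : CobhamSubst.IsProperFixedPoint σ y) (hz : CobhamSubst.IsProperFixedPoint τ z)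
    (φ : A → C) (ψ : B → C) (x : ℕ → C)
    (hφ : ∀ n, φ (y n) = x n) (hψ : ∀ n, ψ (z n) = x n)
    (u : List C) (hu : (CobhamSubst.occurrences x u).Infinite) :
    CobhamSubst.HasBoundedGaps (CobhamSubst.occurrences x u) := by
  obtain ⟨s, c, p, hp, hs, hsc⟩ := CobhamSubst.exists_hasScaling hσ hσα hy
  obtain ⟨s', c', p', hp', hs', hsc'⟩ := CobhamSubst.exists_hasScaling hτ hτβ hz
  -- The scaling ratios are `α ^ p` and `β ^ p'`, so a relation between their powers is one between
  -- powers of `α` and `β`.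
  refine CobhamSubst.hasBoundedGaps_of_scalings hsc (hs.blocks u.length)
    (CobhamSubst.letterDetermined_occurrences hφ u) hsc' (hs'.blocks u.length)
    (CobhamSubst.letterDetermined_occurrences hψ u) (fun k l hk hl => ?_) hu
  rw [← pow_mul, ← pow_mul]
  exact hαβ _ _ (Nat.mul_pos hp hk) (Nat.mul_pos hp' hl)
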